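/- **Binary model.** Random two-terminal directed multigraphs are grown as follows. In step $1$ one starts with a single edge labelled $1$ from the source to the sink. In step $n>1$ one of the $n-1$ existing edges is chosen uniformly at random, say edge $j=(x,y)$. If the node $x$ has out-degree $1$, a further edge $(x,y)$ labelled $n$ is added (parallel doubling). Otherwise $x$ has out-degree $2$, and edge $j$ is replaced by two edges $(x,z)$ and $(z,y)$, where $z$ is a new node, $(x,z)$ keeps the label $j$ and $(z,y)$ gets the label $n$ (serial doubling). The result after step $n$ is a random network of size $n$. **Theorem.** Let $D_n$ ($n\ge 1$) be the random variable measuring the degree of the sink in a random series-parallel network of size $n$ generated by the binary model. For every $n\ge 1$, $$\mathbb{E}(D_n)=\frac{1+\sqrt2}{2}\binom{n+\sqrt2-2}{n-1}-\frac{\sqrt2-1}{2}\binom{n-\sqrt2-2}{n-1},$$ where $\binom{x}{k}=x(x-1)\cdots(x-k+1)/k!$, and, as $n\to\infty$, $$\mathbb{E}(D_n)\sim\frac{1+\sqrt2}{2}\,\frac{n^{\sqrt2-1}}{\Gamma(\sqrt2)}.$$ Moreover, as $n\to\infty$, $D_n/n^{\sqrt2-1}$ converges in distribution to a random variable $D$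 all of whose integer moments exist and are given by $$\mathbb{E}(D^r)=\frac{r!\,\bigl(r(\sqrt2-1)+1\bigr)\,c_r}{\Gamma\bigl(r(\sqrt2-1)+1\bigr)},\qquad r\ge 0,$$ where $c_0=1$, $c_1=\frac{1+\sqrt2}{2\sqrt2}$ and $$c_r=\frac{1}{\bigl(r(\sqrt2-1)+1\bigr)^2-2}\sum_{k=1}^{r-1}c_k\,c_{r-k},\qquad r\ge 2,$$ and the law of $D$ is characterized by these moments, i.e. it is the only probability measure on $\mathbb{R}$ with this sequence of moments. -/

import Mathlib

open MeasureTheory ProbabilityTheory Filter Topology Asymptotics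

/-- A two-terminal directed multigraph with `n` labelled edges. The edge with label `j + 1` is
`j : Fin n`, directed from `tail j` to `head j`. Nodes are named by natural numbers; the source is
`0` and the sink is `1`. -/
@[ext]
structure SPNetwork (n : ℕ) where
  tail : Fin n → ℕ
  head : Fin n → ℕ

namespace SPNetwork

/-- The name of the source. -/
def source : ℕ := 0

/-- The name of the sink. -/
def sink : ℕ := 1

/-- The network consisting of a single edge from the source to the sink. -/
def single : SPNetwork 1 where
  tail := fun _ => source
  head := fun _ => sink

variable {n : ℕ}

/-- The number of edges leaving the node `x`. -/
def outDegree (G : SPNetwork n) (x : ℕ) : ℕ :=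
  (Finset.univ.filter fun e : Fin n => G.tail e = x).card

/-- The number of edges entering the node `x`. -/
def inDegree (G : SPNetwork n) (x : ℕ) : ℕ :=
  (Finset.univ.filter fun e : Fin n => G.head e = x).card

/-- The degree of the sink. All edges are directed towards the sink, so this is its in-degree. -/
def sinkDegree (G : SPNetwork n) : ℕ := G.inDegree sink

/-- Parallel doubling of the edge `j = (x, y)`: a new edge `(x, y)` with label `n + 1` is added. -/
def parallel (G : SPNetwork n) (j : Fin n) : SPNetwork (n + 1) where
  tail := Fin.snoc G.tail (G.tail j)
  head := Fin.snoc G.head (G.head j)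

/-- Serial doubling of the edge `j = (x, y)`: it is replaced by `(x, z)`, which keeps the label of
`j`, and `(z, y)`, which gets the label `n + 1`. The new node `z` has the name `n + 1`, which is
unused: the inner nodes of a network with `n` edges are named by labels of edges, hence by numbers
at most `n`, and the poles are `0` and `1`. -/
def serial (G : SPNetwork n) (j : Fin n) : SPNetwork (n + 1) where
  tail := Fin.snoc G.tail (n + 1)
  head := Fin.snoc (Function.update G.head j (n + 1)) (G.head j)

/-- The binary saturation rule: the edge `j = (x, y)` is doubled in a parallel way if `x` has
out-degree `1`, and in a serial way otherwise. (Of two edges with the same tail the left one is the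
one with the smaller label, so that the left-to-right order need not be recorded.) -/
def grow (G : SPNetwork n) (j : Fin n) : SPNetwork (n + 1) :=
  if G.outDegree (G.tail j) = 1 then G.parallel j else G.serial j

/-- The σ-algebra of all sets of networks. -/
instance : MeasurableSpace (SPNetwork n) := ⊤

instance : DiscreteMeasurableSpace (SPNetwork n) := ⟨fun _ => trivial⟩

/-- The law of the random network with `n` edges in the binary model: start with a single edge, and
in each step choose one of the existing edges uniformly at random and double it according to the
binary saturation rule. (The case `n = 0` is the network without edges, a convention.) -/
noncomputable def binaryModel : (n : ℕ) → PMF (SPNetwork n)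
  | 0 => PMF.pure ⟨fun _ => source, fun _ => sink⟩
  | 1 => PMF.pure single
  | n + 2 => (binaryModel (n + 1)).bind fun G => (PMF.uniformOfFintype (Fin (n + 1))).map G.grow

end SPNetwork

/-! Call an edge into the sink single if it is the only edge leaving its tail, and paired otherwise;
let `a` and `b` count the two kinds. Choosing a single edge sends `(a, b)` to `(a - 1, b + 2)`,
choosing a paired one sends it to `(a + 1, b - 1)`, and any other choice changes nothing. So `(a,
b)` is a two-colour urn, started at `(1, 0)`, whose linear drift has the eigenvalues `√2 - 1` and
`-1 - √2`. An eigenfunction of `generator` with eigenvalue `x` has mean `risingProd x n` times its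
initial value, and `a + b` is a combination of the two linear eigenfunctions; this gives the exact
mean and its asymptotics (`mean_add_eq`).

For the limit law, let `S` and `Q` be power series with `ρ X Q' = S - Q` and `ρ X S' = Q² - S`,
where `ρ = √2 - 1`. By the product rule `generator` acts on `S ^ a * Q ^ b` as `ρ X d/dX`, so its
`r`-th coefficient is an eigenfunction with eigenvalue `r ρ` (`generator_coeff_eigenSeries`). The
equations for `S` and `Q` are the recursion for `c_r`. Hence the mean of `S(s) ^ a * Q(s) ^ b` is an
explicit series. At `s = i t / (n + 1) ^ ρ` it converges, by Euler's limit for `Γ`, to an entire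
function of `t` (`tendsto_mean_eigenSeries`). To first order `S(s) ^ a * Q(s) ^ b` is `exp (c_1 (√2
a + b) s)`, and `a + b` differs from `c_1 (√2 a + b)` by a multiple of the decaying eigenfunction,
which is of smaller order. So the entire function is the limit of the characteristic functions of
the scaled degree. Lévy's continuity theorem yields the limit law, bounded exponential moments make
its moments the Taylor coefficients, and their growth makes the moment problem determinate. -/

/-! ### Integrals with respect to probability mass functions -/

namespace PMF

variable {α β E : Type*} [MeasurableSpace α] [MeasurableSpace β] [NormedAddCommGroup E]

lemma integrable_of_finite_support [DiscreteMeasurableSpace α] [Countable α] (p : PMF α)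
    (hp : p.support.Finite) (f : α → E) : Integrable f p.toMeasure := by
  obtain ⟨C, hC⟩ := (hp.image fun x => ‖f x‖).bddAbove
  refine Integrable.of_bound (C := C) ?_ ?_
  · exact AEStronglyMeasurable.of_discrete
  · have : ∀ᵐ x ∂p.toMeasure, x ∈ p.support := by
      rw [ae_iff]
      refine (p.toMeasure_apply_eq_zero_iff (MeasurableSet.of_discrete)).2 ?_
      exact Set.disjoint_left.2 fun x hx hx' => hx' hx
    filter_upwards [this] with x hx
    exact hC ⟨x, hx, rfl⟩

lemma ae_of_forall_mem_support [DiscreteMeasurableSpace α] (p : PMF α) {q : α → Prop}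
    (h : ∀ x ∈ p.support, q x) : ∀ᵐ x ∂p.toMeasure, q x := by
  rw [ae_iff]
  refine (p.toMeasure_apply_eq_zero_iff (MeasurableSet.of_discrete)).2 ?_
  exact Set.disjoint_left.2 fun x hx hx' => hx' (h x hx)

lemma integral_eq_sum_of_finite_support [NormedSpace ℝ E] [CompleteSpace E]
    [DiscreteMeasurableSpace α] [Countable α] (p : PMF α) (hp : p.support.Finite) (f : α → E) :
    ∫ x, f x ∂p.toMeasure = ∑ x ∈ hp.toFinset, (p x).toReal • f x := by
  rw [integral_eq_tsum p f (p.integrable_of_finite_support hp f)]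
  refine tsum_eq_sum fun x hx => ?_
  have : p x = 0 := by simpa using hx
  simp [this]

lemma integral_bind [NormedSpace ℝ E] [DiscreteMeasurableSpace α] [Countable α]
    (p : PMF α) (q : α → PMF β) (f : β → E)
    (hf : Integrable f (p.bind q).toMeasure) :
    ∫ x, f x ∂(p.bind q).toMeasure = ∫ a, ∫ x, f x ∂(q a).toMeasure ∂p.toMeasure := by
  let κ : Kernel α β := ⟨fun a => (q a).toMeasure, Measurable.of_discrete⟩
  have h : (p.bind q).toMeasure = (κ ∘ₖ Kernel.const Unit p.toMeasure) () := by
    ext s hs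
    rw [Kernel.comp_apply, Kernel.const_apply, Measure.bind_apply hs (Kernel.aemeasurable _),
      lintegral_countable', toMeasure_bind_apply _ _ _ hs]
    refine tsum_congr fun a => ?_
    rw [toMeasure_apply_singleton _ _ (measurableSet_singleton a), mul_comm]
    rfl
  rw [h] at hf ⊢
  rw [Kernel.integral_comp hf]
  rfl

end PMF

/-! ### Support of the model and the one-step recursion for integrals. -/

namespace SPNetwork

variable {n : ℕ}

instance : Countable (SPNetwork n) :=
  Function.Injective.countable (f := fun G : SPNetwork n => (G.tail, G.head)) fun G H h => by
    simpa [SPNetwork.ext_iff] using h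

lemma support_binaryModel_succ (n : ℕ) :
    (binaryModel (n + 2)).support =
      ⋃ G ∈ (binaryModel (n + 1)).support, Set.range (G.grow) := by
  ext H
  simp [binaryModel]

lemma finite_support_binaryModel : ∀ n, (binaryModel n).support.Finite
  | 0 => by simp [binaryModel]
  | 1 => by simp [binaryModel]
  | n + 2 => by
    rw [support_binaryModel_succ]
    exact (finite_support_binaryModel (n + 1)).biUnion fun G _ => Set.finite_range _

lemma integrable_binaryModel {E : Type*} [NormedAddCommGroup E] (f : SPNetwork n → E) :
    Integrable f (binaryModel n).toMeasure :=
  PMF.integrable_of_finite_support _ (finite_support_binaryModel n) f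

lemma integral_binaryModel_succ {E : Type*} [NormedAddCommGroup E] [NormedSpace ℝ E]
    [CompleteSpace E] (f : SPNetwork (n + 2) → E) :
    ∫ G, f G ∂(binaryModel (n + 2)).toMeasure =
      ∫ G : SPNetwork (n + 1), ((n + 1 : ℕ) : ℝ)⁻¹ • ∑ j, f (G.grow j)
        ∂(binaryModel (n + 1)).toMeasure := by
  have h := integrable_binaryModel (n := n + 2) f
  rw [binaryModel] at h ⊢
  rw [PMF.integral_bind _ _ _ h]
  congr 1 with G
  rw [← PMF.toMeasure_map (f := G.grow) _ Measurable.of_discrete,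
    integral_map Measurable.of_discrete.aemeasurable AEStronglyMeasurable.of_discrete,
    PMF.integral_eq_sum, Finset.smul_sum]
  have : ((n : ENNReal) + 1).toReal = n + 1 := by rw [ENNReal.toReal_add] <;> simp
  simp [this]

/-! ### Growth of the edges at the sink -/

/-- Guarantees that the name given to the new node in the next serial doubling is not yet a tail. -/
lemma tail_le_of_mem_support : ∀ (n : ℕ), ∀ G ∈ (binaryModel (n + 1)).support,
    ∀ e, G.tail e ≤ n + 1
  | 0, G, hG, e => by
    simp only [binaryModel, PMF.support_pure, Set.mem_singleton_iff] at hG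
    simp [hG, single, source]
  | n + 1, G, hG, e => by
    rw [support_binaryModel_succ] at hG
    simp only [Set.mem_iUnion, Set.mem_range] at hG
    obtain ⟨H, hH, j, rfl⟩ := hG
    have ih := tail_le_of_mem_support n H hH
    unfold grow
    split_ifs
    · refine Fin.lastCases ?_ (fun i => ?_) e
      · simpa [parallel] using (ih j).trans (Nat.le_succ _)
      · simpa [parallel] using (ih i).trans (Nat.le_succ _)
    · refine Fin.lastCases ?_ (fun i => ?_) e
      · simp [serial]
      · simpa [serial] using (ih i).trans (Nat.le_succ _)

/-- The number of edges into the sink which are the only edge leaving their tail. -/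
def singleCount (G : SPNetwork n) : ℕ :=
  ∑ e, if G.head e = sink ∧ G.outDegree (G.tail e) = 1 then 1 else 0

/-- The number of edges into the sink whose tail has further edges leaving it. -/
def pairedCount (G : SPNetwork n) : ℕ :=
  ∑ e, if G.head e = sink ∧ G.outDegree (G.tail e) ≠ 1 then 1 else 0

lemma sinkDegree_eq (G : SPNetwork n) : G.sinkDegree = G.singleCount + G.pairedCount := by
  rw [sinkDegree, inDegree, Finset.card_filter, singleCount, pairedCount, ← Finset.sum_add_distrib]
  refine Finset.sum_congr rfl fun e _ => ?_
  by_cases h : G.head e = sink <;> by_cases h' : G.outDegree (G.tail e) = 1 <;> simp [h, h']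

lemma outDegree_eq_sum (G : SPNetwork n) (x : ℕ) :
    G.outDegree x = ∑ e, if G.tail e = x then 1 else 0 := by
  rw [outDegree, Finset.card_filter]

lemma outDegree_parallel (G : SPNetwork n) (j : Fin n) (x : ℕ) :
    (G.parallel j).outDegree x = G.outDegree x + if G.tail j = x then 1 else 0 := by
  rw [outDegree_eq_sum, outDegree_eq_sum, Fin.sum_univ_castSucc]
  simp only [parallel, Fin.snoc_castSucc, Fin.snoc_last]

lemma outDegree_serial (G : SPNetwork n) (j : Fin n) (x : ℕ) :
    (G.serial j).outDegree x = G.outDegree x + if n + 1 = x then 1 else 0 := by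
  rw [outDegree_eq_sum, outDegree_eq_sum, Fin.sum_univ_castSucc]
  simp only [serial, Fin.snoc_castSucc, Fin.snoc_last]

lemma eq_of_tail_eq {G : SPNetwork n} {j e : Fin n} (hj : G.outDegree (G.tail j) = 1)
    (h : G.tail e = G.tail j) : e = j := by
  obtain ⟨i, hi⟩ := Finset.card_eq_one.1 hj
  have h₁ : e ∈ ({i} : Finset (Fin n)) := hi ▸ by simp [h]
  have h₂ : j ∈ ({i} : Finset (Fin n)) := hi ▸ by simp
  rw [Finset.mem_singleton.1 h₁, Finset.mem_singleton.1 h₂]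

/-- Only `G.tail j` gains an outgoing edge, and `j` was the only edge leaving it, so no other old
edge changes kind. The additive form avoids truncated subtraction. -/
lemma singleCount_parallel {G : SPNetwork n} {j : Fin n} (hj : G.outDegree (G.tail j) = 1) :
    (G.parallel j).singleCount + (if G.head j = sink then 1 else 0) = G.singleCount := by
  have key : ∀ e, (if G.head e = sink ∧ G.outDegree (G.tail e) = 1 then 1 else 0) =
      (if G.head e = sink ∧ (G.parallel j).outDegree (G.tail e) = 1 then 1 else 0) +
        if e = j then (if G.head j = sink then 1 else 0) else 0 := fun e => by
    rw [outDegree_parallel]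
    by_cases he : e = j
    · subst he; simp [hj]
    · have : G.tail j ≠ G.tail e := fun h => he (eq_of_tail_eq hj h.symm)
      simp [he, this]
  have key' := Finset.sum_congr (rfl : (Finset.univ : Finset (Fin n)) = _) fun e _ => key e
  rw [Finset.sum_add_distrib, Finset.sum_ite_eq'] at key'
  simp only [Finset.mem_univ, if_true] at key'
  rw [singleCount, singleCount, key', Fin.sum_univ_castSucc]
  have : (G.parallel j).outDegree (G.tail j) = 2 := by rw [outDegree_parallel]; simp [hj]
  have h₁ : ∀ e : Fin n, (G.parallel j).tail e.castSucc = G.tail e := by simp [parallel]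
  have h₂ : ∀ e : Fin n, (G.parallel j).head e.castSucc = G.head e := by simp [parallel]
  have h₃ : (G.parallel j).tail (Fin.last n) = G.tail j := by simp [parallel]
  simp [h₁, h₂, h₃, this]

lemma pairedCount_parallel {G : SPNetwork n} {j : Fin n} (hj : G.outDegree (G.tail j) = 1) :
    (G.parallel j).pairedCount = G.pairedCount + if G.head j = sink then 2 else 0 := by
  have key : ∀ e, (if G.head e = sink ∧ (G.parallel j).outDegree (G.tail e) ≠ 1 then 1 else 0) =
      (if G.head e = sink ∧ G.outDegree (G.tail e) ≠ 1 then 1 else 0) +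
        if e = j then (if G.head j = sink then 1 else 0) else 0 := fun e => by
    rw [outDegree_parallel]
    by_cases he : e = j
    · subst he; simp [hj]
    · have : G.tail j ≠ G.tail e := fun h => he (eq_of_tail_eq hj h.symm)
      simp [he, this]
  have key' := Finset.sum_congr (rfl : (Finset.univ : Finset (Fin n)) = _) fun e _ => key e
  rw [Finset.sum_add_distrib, Finset.sum_ite_eq'] at key'
  simp only [Finset.mem_univ, if_true] at key'
  rw [pairedCount, pairedCount, Fin.sum_univ_castSucc]
  have : (G.parallel j).outDegree (G.tail j) = 2 := by rw [outDegree_parallel]; simp [hj]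
  have h₁ : ∀ e : Fin n, (G.parallel j).tail e.castSucc = G.tail e := by simp [parallel]
  have h₂ : ∀ e : Fin n, (G.parallel j).head e.castSucc = G.head e := by simp [parallel]
  have h₃ : (G.parallel j).tail (Fin.last n) = G.tail j := by simp [parallel]
  have h₄ : (G.parallel j).head (Fin.last n) = G.head j := by simp [parallel]
  simp only [h₁, h₂, h₃, h₄, this, key']
  -- The `2` counts `j`, which has become paired, and its new parallel copy.
  split_ifs <;> simp_all

lemma singleCount_serial {G : SPNetwork n} {j : Fin n} (hj : G.outDegree (G.tail j) ≠ 1)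
    (hG : ∀ e, G.tail e ≤ n) :
    (G.serial j).singleCount = G.singleCount + if G.head j = sink then 1 else 0 := by
  have hn : n ≠ 0 := fun h => by subst h; exact j.elim0
  have h₀ : ∀ e, (G.serial j).outDegree (G.tail e) = G.outDegree (G.tail e) := fun e => by
    have := hG e
    rw [outDegree_serial, if_neg (by omega), add_zero]
  have hz : (G.serial j).outDegree (n + 1) = 1 := by
    rw [outDegree_serial, if_pos rfl, outDegree_eq_sum, Finset.sum_eq_zero]
    intro e _
    have := hG e
    rw [if_neg (by omega)]
  have h₁ : ∀ e : Fin n, (G.serial j).tail e.castSucc = G.tail e := by simp [serial]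
  have h₂ : ∀ e : Fin n, (G.serial j).head e.castSucc = if e = j then n + 1 else G.head e := by
    simp [serial, Function.update_apply]
  have h₃ : (G.serial j).tail (Fin.last n) = n + 1 := by simp [serial]
  have h₄ : (G.serial j).head (Fin.last n) = G.head j := by
    simp [serial, (Fin.castSucc_lt_last j).ne']
  rw [singleCount, singleCount, Fin.sum_univ_castSucc]
  simp only [h₁, h₂, h₃, h₄, h₀, hz]
  congr 1
  · refine Finset.sum_congr rfl fun e _ => ?_
    by_cases he : e = j
    · subst he; simp [hj]
    · simp [he]
  · simp

/-- Edge `j` now ends at the new node and so leaves the sink; other edges with the same tail stay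
paired, since out-degrees of old tails do not change. The new edge is single. -/
lemma pairedCount_serial {G : SPNetwork n} {j : Fin n} (hj : G.outDegree (G.tail j) ≠ 1)
    (hG : ∀ e, G.tail e ≤ n) :
    (G.serial j).pairedCount + (if G.head j = sink then 1 else 0) = G.pairedCount := by
  have hn : n ≠ 0 := fun h => by subst h; exact j.elim0
  have h₀ : ∀ e, (G.serial j).outDegree (G.tail e) = G.outDegree (G.tail e) := fun e => by
    have := hG e
    rw [outDegree_serial, if_neg (by omega), add_zero]
  have hz : (G.serial j).outDegree (n + 1) = 1 := by
    rw [outDegree_serial, if_pos rfl, outDegree_eq_sum, Finset.sum_eq_zero]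
    intro e _
    have := hG e
    rw [if_neg (by omega)]
  have h₁ : ∀ e : Fin n, (G.serial j).tail e.castSucc = G.tail e := by simp [serial]
  have h₂ : ∀ e : Fin n, (G.serial j).head e.castSucc = if e = j then n + 1 else G.head e := by
    simp [serial, Function.update_apply]
  have h₃ : (G.serial j).tail (Fin.last n) = n + 1 := by simp [serial]
  have key : ∀ e, (if G.head e = sink ∧ G.outDegree (G.tail e) ≠ 1 then 1 else 0) =
      (if (if e = j then n + 1 else G.head e) = sink ∧ G.outDegree (G.tail e) ≠ 1 then 1 else 0) +
        if e = j then (if G.head j = sink then 1 else 0) else 0 := fun e => by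
    by_cases he : e = j
    -- The new node `n + 1` would coincide with the sink `1` if `n` were `0`.
    · have : n + 1 ≠ sink := by simp [sink, hn]
      subst he; simp [hj, this]
    · simp [he]
  have key' := Finset.sum_congr (rfl : (Finset.univ : Finset (Fin n)) = _) fun e _ => key e
  rw [Finset.sum_add_distrib, Finset.sum_ite_eq'] at key'
  simp only [Finset.mem_univ, if_true] at key'
  rw [pairedCount, pairedCount, Fin.sum_univ_castSucc, key']
  simp [h₁, h₂, h₃, h₀, hz]

/-- The function `f` of the numbers of edges into the sink of the two kinds, with the growth
of the network at all the edges into the sink averaged out. -/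
noncomputable def generator {E : Type*} [AddCommGroup E] [Module ℝ E] (f : ℕ → ℕ → E) (a b : ℕ) :
    E :=
  (a : ℝ) • (f (a - 1) (b + 2) - f a b) + (b : ℝ) • (f (a + 1) (b - 1) - f a b)

/-- This is where the pair of counts becomes a Markov chain by itself: the sum over all choices of
`j` depends on `G` only through the two counts. -/
lemma sum_grow {E : Type*} [AddCommGroup E] [Module ℝ E] (f : ℕ → ℕ → E) (G : SPNetwork n)
    (hG : ∀ e, G.tail e ≤ n) :
    ∑ j, f (G.grow j).singleCount (G.grow j).pairedCount =
      (n : ℝ) • f G.singleCount G.pairedCount + generator f G.singleCount G.pairedCount := by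
  have key : ∀ j, f (G.grow j).singleCount (G.grow j).pairedCount =
      f G.singleCount G.pairedCount +
      (((if G.head j = sink ∧ G.outDegree (G.tail j) = 1 then 1 else 0 : ℕ) : ℝ) •
        (f (G.singleCount - 1) (G.pairedCount + 2) - f G.singleCount G.pairedCount) +
      ((if G.head j = sink ∧ G.outDegree (G.tail j) ≠ 1 then 1 else 0 : ℕ) : ℝ) •
        (f (G.singleCount + 1) (G.pairedCount - 1) - f G.singleCount G.pairedCount)) := fun j => by
    by_cases h : G.outDegree (G.tail j) = 1
    · have h₁ := singleCount_parallel h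
      rw [grow, if_pos h, pairedCount_parallel h]
      by_cases hs : G.head j = sink
      · have : (G.parallel j).singleCount = G.singleCount - 1 := by simp [hs] at h₁; omega
        simp [hs, h, this]
      · have : (G.parallel j).singleCount = G.singleCount := by simp [hs] at h₁; omega
        simp [hs, this]
    · have h₁ := pairedCount_serial h hG
      rw [grow, if_neg h, singleCount_serial h hG]
      by_cases hs : G.head j = sink
      · have : (G.serial j).pairedCount = G.pairedCount - 1 := by simp [hs] at h₁; omega
        simp [hs, h, this]
      · have : (G.serial j).pairedCount = G.pairedCount := by simp [hs] at h₁; omega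
        simp [hs, this]
  rw [Finset.sum_congr rfl fun j _ => key j, Finset.sum_add_distrib, Finset.sum_add_distrib,
    ← Finset.sum_smul, ← Finset.sum_smul, ← Nat.cast_sum, ← Nat.cast_sum]
  simp [generator, singleCount, pairedCount, Nat.cast_smul_eq_nsmul]

/-- The mean of a function of the numbers of edges into the sink of the two kinds, in the random
network with `n + 1` edges. -/
noncomputable def mean {E : Type*} [NormedAddCommGroup E] [NormedSpace ℝ E] (n : ℕ)
    (f : ℕ → ℕ → E) : E :=
  ∫ G : SPNetwork (n + 1), f G.singleCount G.pairedCount ∂(binaryModel (n + 1)).toMeasure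

section mean

variable {E : Type*} [NormedAddCommGroup E] [NormedSpace ℝ E]

lemma mean_zero [CompleteSpace E] (f : ℕ → ℕ → E) : mean 0 f = f 1 0 := by
  have h : (binaryModel 1).toMeasure = Measure.dirac single := by
    rw [binaryModel, PMF.toMeasure_pure]
  have h₁ : single.singleCount = 1 := by
    simp [singleCount, single, outDegree]
  have h₂ : single.pairedCount = 0 := by
    simp [pairedCount, single, outDegree]
  rw [mean]
  change ∫ G, f G.singleCount G.pairedCount ∂(binaryModel 1).toMeasure = _
  rw [h, integral_dirac, h₁, h₂]

lemma mean_succ [CompleteSpace E] (n : ℕ) (f : ℕ → ℕ → E) :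
    mean (n + 1) f = mean n f + ((n + 1 : ℕ) : ℝ)⁻¹ • mean n (generator f) := by
  rw [mean, integral_binaryModel_succ, mean, mean, ← integral_smul,
    ← integral_add (integrable_binaryModel _) (integrable_binaryModel _)]
  refine integral_congr_ae ?_
  filter_upwards [PMF.ae_of_forall_mem_support _ (tail_le_of_mem_support n)] with G hG
  rw [sum_grow f G hG, smul_add, smul_smul, inv_mul_cancel₀ (by positivity), one_smul]

lemma mean_add (n : ℕ) (f g : ℕ → ℕ → E) :
    mean n (fun a b => f a b + g a b) = mean n f + mean n g :=
  integral_add (integrable_binaryModel _) (integrable_binaryModel _)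

lemma mean_sub (n : ℕ) (f g : ℕ → ℕ → E) :
    mean n (fun a b => f a b - g a b) = mean n f - mean n g :=
  integral_sub (integrable_binaryModel _) (integrable_binaryModel _)

lemma mean_const_mul {𝕜 : Type*} [RCLike 𝕜] (n : ℕ) (c : 𝕜) (f : ℕ → ℕ → 𝕜) :
    mean n (fun a b => c * f a b) = c * mean n f :=
  integral_const_mul _ _

lemma mean_const [CompleteSpace E] (n : ℕ) (c : E) : mean n (fun _ _ => c) = c := by
  simp [mean]

lemma mean_mono (n : ℕ) {f g : ℕ → ℕ → ℝ} (h : ∀ a b, f a b ≤ g a b) : mean n f ≤ mean n g :=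
  integral_mono (integrable_binaryModel _) (integrable_binaryModel _) fun _ => h _ _

lemma mean_nonneg (n : ℕ) {f : ℕ → ℕ → ℝ} (h : ∀ a b, 0 ≤ f a b) : 0 ≤ mean n f :=
  integral_nonneg fun _ => h _ _

lemma norm_mean_le (n : ℕ) (f : ℕ → ℕ → E) : ‖mean n f‖ ≤ mean n fun a b => ‖f a b‖ :=
  norm_integral_le_integral_norm _

lemma mean_ofReal {𝕜 : Type*} [RCLike 𝕜] (n : ℕ) (f : ℕ → ℕ → ℝ) :
    mean n (fun a b => (f a b : 𝕜)) = ((mean n f : ℝ) : 𝕜) :=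
  integral_ofReal

/-- The support is finite, so the mean is a finite sum and commutes with series without any
domination. -/
lemma hasSum_mean [CompleteSpace E] (n : ℕ) {f : ℕ → ℕ → ℕ → E} {g : ℕ → ℕ → E}
    (h : ∀ a b, HasSum (fun r => f r a b) (g a b)) :
    HasSum (fun r => mean n (f r)) (mean n g) := by
  simp only [mean, PMF.integral_eq_sum_of_finite_support _ (finite_support_binaryModel (n + 1))]
  exact hasSum_sum fun G _ => (h _ _).const_smul _

end mean

end SPNetwork

/-! ### The products `(1 + x) (1 + x / 2) ⋯ (1 + x / n)` -/

/-- The product of the numbers `1 + x / k` for `1 ≤ k ≤ n`. -/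
noncomputable def risingProd (x : ℝ) (n : ℕ) : ℝ := ∏ k ∈ Finset.range n, (1 + x / (k + 1))

lemma risingProd_zero (x : ℝ) : risingProd x 0 = 1 := by simp [risingProd]

lemma risingProd_succ (x : ℝ) (n : ℕ) :
    risingProd x (n + 1) = risingProd x n * (1 + x / (n + 1)) := by
  rw [risingProd, Finset.prod_range_succ, risingProd]

lemma risingProd_pos {x : ℝ} (hx : 0 ≤ x) (n : ℕ) : 0 < risingProd x n :=
  Finset.prod_pos fun k _ => by positivity

lemma factorial_mul_risingProd (x : ℝ) (n : ℕ) :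
    n.factorial * risingProd x n = (ascPochhammer ℝ n).eval (x + 1) := by
  induction n with
  | zero => simp [risingProd]
  | succ n ih =>
    rw [risingProd_succ, ascPochhammer_succ_eval, ← ih, Nat.factorial_succ]
    push_cast
    field_simp
    ring

lemma choose_eq_risingProd (x : ℝ) (n : ℕ) : Ring.choose (x + n) n = risingProd x n := by
  have h := Ring.factorial_nsmul_multichoose_eq_ascPochhammer (x + 1) n
  rw [Polynomial.ascPochhammer_smeval_eq_eval, ← factorial_mul_risingProd, Ring.multichoose_eq,
    nsmul_eq_mul] at h
  rw [show x + n = x + 1 + n - 1 by ring]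
  exact mul_left_cancel₀ (by positivity) h

/-- Only the first factor can exceed `1` in absolute value: from the second on, `x / (k + 1) ≥ -2`.
Used at `x = -1 - √2`. -/
lemma abs_risingProd_le_of_nonpos {x : ℝ} (hx : x ≤ 0) (hx' : -4 ≤ x) (n : ℕ) :
    |risingProd x n| ≤ 3 := by
  have h₀ : |1 + x| ≤ 3 := abs_le.2 ⟨by linarith, by linarith⟩
  have h₁ : ∀ k : ℕ, 1 ≤ k → |1 + x / (k + 1)| ≤ 1 := fun k hk => by
    have hk' : (1 : ℝ) ≤ k := by exact_mod_cast hk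
    have : x / (k + 1) ≤ 0 := div_nonpos_of_nonpos_of_nonneg hx (by positivity)
    have : -2 ≤ x / (k + 1) := by
      rw [le_div_iff₀ (by positivity)]; linarith
    exact abs_le.2 ⟨by linarith, by linarith⟩
  induction n with
  | zero => simp [risingProd]
  | succ n ih =>
    rcases Nat.eq_zero_or_pos n with rfl | hn
    · simpa [risingProd] using h₀
    · rw [risingProd_succ, abs_mul]
      calc _ ≤ |risingProd x n| * 1 := by gcongr; exact h₁ n hn
        _ ≤ 3 := by simpa using ih

/-- Euler's limit: up to factors tending to `1`, the quotient is the inverse of `Real.GammaSeq (x +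
1) n`. -/
lemma tendsto_risingProd_div_rpow {x : ℝ} (hx : 0 ≤ x) :
    Tendsto (fun n : ℕ => risingProd x n / ((n : ℝ) + 1) ^ x) atTop
      (𝓝 (1 / Real.Gamma (x + 1))) := by
  have hΓ : Real.Gamma (x + 1) ≠ 0 := (Real.Gamma_pos_of_pos (by linarith)).ne'
  have h₁ : Tendsto (fun n : ℕ => (n : ℝ) / (n + 1)) atTop (𝓝 1) := by
    simpa using tendsto_natCast_div_add_atTop (𝕜 := ℝ) 1
  have h₂ : Tendsto (fun n : ℕ => (n : ℝ) / (n + (x + 1))) atTop (𝓝 1) :=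
    tendsto_natCast_div_add_atTop (𝕜 := ℝ) (x + 1)
  have h₃ : Tendsto (fun n : ℕ => ((n : ℝ) / (n + 1)) ^ x) atTop (𝓝 1) := by
    simpa using h₁.rpow_const (p := x) (Or.inl one_ne_zero)
  have h₄ := (Real.GammaSeq_tendsto_Gamma (x + 1)).inv₀ hΓ
  have h₅ := (h₃.mul h₂).mul h₄
  rw [one_mul, one_mul, ← one_div] at h₅
  refine h₅.congr' ?_
  filter_upwards [eventually_ge_atTop 1] with n hn
  have hn' : (0 : ℝ) < n := by exact_mod_cast hn
  have h₆ : ∀ m : ℕ, ∏ j ∈ Finset.range m, (x + 1 + j) = m.factorial * risingProd x m := fun m => by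
    rw [factorial_mul_risingProd]
    induction m with
    | zero => simp
    | succ m ih => rw [Finset.prod_range_succ, ih, ascPochhammer_succ_eval]
  rw [Real.GammaSeq, Finset.prod_range_succ, h₆, Real.div_rpow hn'.le (by positivity),
    Real.rpow_add_one hn'.ne']
  have := (risingProd_pos hx n).ne'
  have : (n : ℝ) ^ x ≠ 0 := by positivity
  field_simp
  ring

/-- The first `N` factors are bounded crudely by `1 + x`, the later ones by telescoping powers. For
fixed `N` the bound is polynomial in `x` times `(n / N) ^ x`, which is what makes the sums over `x =
r ρ` converge. -/
lemma risingProd_le {x : ℝ} (hx : 0 ≤ x) {N n : ℕ} (hN : 1 ≤ N) (hn : N ≤ n) :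
    risingProd x n ≤ (1 + x) ^ N * ((n : ℝ) / N) ^ x := by
  have hN' : (0 : ℝ) < N := by exact_mod_cast hN
  induction n, hn using Nat.le_induction with
  | base =>
    rw [div_self hN'.ne', Real.one_rpow, mul_one, risingProd]
    calc _ ≤ ∏ k ∈ Finset.range N, (1 + x) := by
          refine Finset.prod_le_prod (fun k _ => by positivity) fun k _ => ?_
          gcongr
          exact div_le_self hx (by linarith [(Nat.cast_nonneg k : (0 : ℝ) ≤ k)])
      _ = _ := by simp
  | succ n hn ih =>
    have hn' : (0 : ℝ) < n := hN'.trans_le (by exact_mod_cast hn)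
    have h₁ : 1 + x / (n + 1) ≤ (((n + 1 : ℕ) : ℝ) / n) ^ x := by
      rw [Real.rpow_def_of_pos (by positivity)]
      refine le_trans ?_ (Real.add_one_le_exp _)
      rw [add_comm]
      gcongr
      have := Real.one_sub_inv_le_log_of_pos (x := ((n + 1 : ℕ) : ℝ) / n) (by positivity)
      calc x / (n + 1) = (1 - (((n + 1 : ℕ) : ℝ) / n)⁻¹) * x := by push_cast; field_simp; ring
        _ ≤ _ := by gcongr
    rw [risingProd_succ]
    calc _ ≤ (1 + x) ^ N * ((n : ℝ) / N) ^ x * (((n + 1 : ℕ) : ℝ) / n) ^ x := by gcongr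
      _ = _ := by
        rw [mul_assoc, ← Real.mul_rpow (by positivity) (by positivity)]
        congr 2
        field_simp

lemma risingProd_div_rpow_le {x : ℝ} (hx : 0 ≤ x) {N n : ℕ} (hN : 1 ≤ N) (hn : N ≤ n) :
    risingProd x n / ((n : ℝ) + 1) ^ x ≤ (1 + x) ^ N / (N : ℝ) ^ x := by
  have hN' : (0 : ℝ) < N := by exact_mod_cast hN
  rw [div_le_iff₀ (by positivity)]
  refine (risingProd_le hx hN hn).trans ?_
  rw [Real.div_rpow (by positivity) (by positivity), div_mul_eq_mul_div, ← mul_div_assoc]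
  gcongr
  linarith

namespace SPNetwork

/-! ### The coefficients of the limiting generating functions -/

/-- The exponent `√2 - 1`. -/
noncomputable def growthRate : ℝ := √2 - 1

local notation "ρ" => growthRate

lemma growthRate_sq : ρ ^ 2 = 1 - 2 * ρ := by
  have : √2 ^ 2 = (2 : ℝ) := Real.sq_sqrt (by norm_num)
  rw [growthRate]
  linarith

lemma growthRate_pos : 0 < ρ := by
  have : (1 : ℝ) < √2 := Real.lt_sqrt_of_sq_lt (by norm_num)
  rw [growthRate]
  linarith

lemma growthRate_lt : ρ < 1 / 2 := by
  nlinarith [growthRate_sq, growthRate_pos]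

lemma sqrt_two_eq : √2 = ρ + 1 := by rw [growthRate]; ring

/-- The numbers `c_r`. -/
noncomputable def limitCoeff : ℕ → ℝ
  | 0 => 1
  | 1 => (1 + √2) / (2 * √2)
  | r + 2 => 1 / (((r + 2 : ℕ) * ρ + 1) ^ 2 - 2) *
      ∑ k : Fin (r + 1), limitCoeff (k + 1) * limitCoeff (r + 1 - k)

lemma limitCoeff_eq {r : ℕ} (hr : 2 ≤ r) :
    limitCoeff r = 1 / ((r * ρ + 1) ^ 2 - 2) *
      ∑ k ∈ Finset.Icc 1 (r - 1), limitCoeff k * limitCoeff (r - k) := by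
  obtain ⟨r, rfl⟩ := Nat.exists_eq_add_of_le' hr
  rw [limitCoeff]
  congr 1
  rw [Fin.sum_univ_eq_sum_range fun k => limitCoeff (k + 1) * limitCoeff (r + 1 - k),
    show Finset.Icc 1 (r + 2 - 1) = Finset.Ico 1 (r + 2) by ext k; simp; omega,
    Finset.sum_Ico_eq_sum_range]
  refine Finset.sum_congr (by simp) fun k _ => ?_
  rw [show r + 2 - (1 + k) = r + 1 - k by omega, add_comm 1 k]

/-- In this form the denominator is visibly at least `r - 1` for `r ≥ 1`, matching the `r - 1` terms
of the recursion. -/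
lemma limitCoeff_denom (r : ℝ) :
    (r * ρ + 1) ^ 2 - 2 = (r - 1) + ρ ^ 2 * (r * (r - 1)) := by
  linear_combination r * growthRate_sq

lemma limitCoeff_one_eq : limitCoeff 1 = (2 + ρ) / (2 * (1 + ρ)) := by
  rw [limitCoeff, sqrt_two_eq]; ring

lemma limitCoeff_one_pos : 0 < limitCoeff 1 := by
  have := growthRate_pos
  rw [limitCoeff_one_eq]; positivity

lemma limitCoeff_mem : ∀ r, limitCoeff r ∈ Set.Icc (0 : ℝ) 1 := by
  intro r
  induction r using Nat.strong_induction_on with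
  | _ r ih =>
    match r, ih with
    | 0, _ => simp [limitCoeff]
    | 1, _ =>
      have := growthRate_pos
      refine ⟨limitCoeff_one_pos.le, ?_⟩
      rw [limitCoeff_one_eq, div_le_one (by positivity)]
      linarith
    | r + 2, ih =>
      have h : ((r : ℝ) + 1) ≤ ((r + 2 : ℕ) * ρ + 1) ^ 2 - 2 := by
        rw [limitCoeff_denom]
        push_cast
        have : 0 ≤ ρ ^ 2 * (((r : ℝ) + 2) * (r + 2 - 1)) := by
          have : (0 : ℝ) ≤ r + 2 - 1 := by linarith [(Nat.cast_nonneg r : (0 : ℝ) ≤ r)]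
          positivity
        linarith
      have h' : 0 < ((r + 2 : ℕ) * ρ + 1) ^ 2 - 2 := lt_of_lt_of_le (by positivity) h
      rw [limitCoeff]
      have hs : ∀ k : Fin (r + 1), limitCoeff (k + 1) * limitCoeff (r + 1 - k) ∈ Set.Icc (0 : ℝ) 1 :=
        fun k => by
          have h₁ := ih (k + 1) (by omega)
          have h₂ := ih (r + 1 - k) (by omega)
          exact ⟨mul_nonneg h₁.1 h₂.1, mul_le_one₀ h₁.2 h₂.1 h₂.2⟩
      constructor
      · exact mul_nonneg (by positivity) (Finset.sum_nonneg fun k _ => (hs k).1)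
      · rw [one_div_mul_eq_div, div_le_one h']
        calc _ ≤ ∑ k : Fin (r + 1), (1 : ℝ) := Finset.sum_le_sum fun k _ => (hs k).2
          _ ≤ _ := by simpa using h

/-- The two end terms `k = 0` and `k = r` absorb the `-2` of the denominator. At `r = 1` the
identity reduces to `(ρ + 1) ^ 2 = 2`, so it leaves `c_1` free. -/
lemma sum_antidiagonal_limitCoeff (r : ℕ) :
    ∑ p ∈ Finset.HasAntidiagonal.antidiagonal r, limitCoeff p.1 * limitCoeff p.2 =
      (r * ρ + 1) ^ 2 * limitCoeff r := by
  match r with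
  | 0 => simp [limitCoeff]
  | 1 =>
    rw [Finset.Nat.sum_antidiagonal_succ]
    simp only [limitCoeff.eq_1, Finset.Nat.antidiagonal_zero, Finset.sum_singleton, Nat.cast_one,
      zero_add]
    linear_combination -limitCoeff 1 * growthRate_sq
  | r + 2 =>
    have h' : ((r + 2 : ℕ) * ρ + 1) ^ 2 - 2 ≠ 0 := by
      rw [limitCoeff_denom]
      push_cast
      have : (0 : ℝ) < (r + 2 - 1) := by linarith [(Nat.cast_nonneg r : (0 : ℝ) ≤ r)]
      have := growthRate_pos
      positivity
    have h : (((r + 2 : ℕ) * ρ + 1) ^ 2 - 2) * limitCoeff (r + 2) =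
        ∑ k : Fin (r + 1), limitCoeff (k + 1) * limitCoeff (r + 1 - k) := by
      rw [limitCoeff, ← mul_assoc, mul_one_div_cancel h', one_mul]
    rw [Finset.Nat.sum_antidiagonal_eq_sum_range_succ (fun i j => limitCoeff i * limitCoeff j),
      Finset.sum_range_succ, Finset.sum_range_succ',
      ← Fin.sum_univ_eq_sum_range fun k => limitCoeff (k + 1) * limitCoeff (r + 2 - (k + 1))]
    have h₂ : ∀ k : ℕ, r + 2 - (k + 1) = r + 1 - k := fun k => by omega
    simp only [h₂, ← h]
    simp [limitCoeff.eq_1]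
    ring

/-! ### The limiting generating functions -/

open PowerSeries

/-- The generating function of the numbers `c_r`. -/
noncomputable def pairedSeries : PowerSeries ℝ := PowerSeries.mk limitCoeff

/-- The generating function of the numbers `(r ρ + 1) c_r`. -/
noncomputable def singleSeries : PowerSeries ℝ :=
  PowerSeries.mk fun r => (r * ρ + 1) * limitCoeff r

lemma coeff_C_mul_X_mul_derivative (x : ℝ) (p : PowerSeries ℝ) (r : ℕ) :
    coeff r (C x * (X * derivative ℝ p)) = x * r * coeff r p := by
  rw [coeff_C_mul, mul_assoc]
  congr 1
  cases r with
  | zero => simp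
  | succ r => rw [coeff_succ_X_mul, coeff_derivative]; push_cast; ring

lemma derivative_pairedSeries :
    C ρ * (X * derivative ℝ pairedSeries) = singleSeries - pairedSeries := by
  ext r
  rw [coeff_C_mul_X_mul_derivative, map_sub, pairedSeries, singleSeries, coeff_mk, coeff_mk]
  ring

lemma derivative_singleSeries :
    C ρ * (X * derivative ℝ singleSeries) = pairedSeries ^ 2 - singleSeries := by
  ext r
  rw [coeff_C_mul_X_mul_derivative, map_sub, sq, coeff_mul]
  simp only [pairedSeries, singleSeries, coeff_mk]
  rw [sum_antidiagonal_limitCoeff]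
  ring

/-- The generating function of the eigenfunctions of `generator`. -/
noncomputable def eigenSeries (a b : ℕ) : PowerSeries ℝ := singleSeries ^ a * pairedSeries ^ b

/-- By the product rule and the two differential equations, `generator` acts on the whole series as
`ρ X d/dX`, which multiplies the `r`-th coefficient by `r ρ`. -/
lemma generator_coeff_eigenSeries (r a b : ℕ) :
    generator (fun a b => coeff r (eigenSeries a b)) a b =
      r * ρ * coeff r (eigenSeries a b) := by
  have h : C (a : ℝ) * (eigenSeries (a - 1) (b + 2) - eigenSeries a b) +
      C (b : ℝ) * (eigenSeries (a + 1) (b - 1) - eigenSeries a b) =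
      C ρ * (X * derivative ℝ (eigenSeries a b)) := by
    rw [eigenSeries, eigenSeries, eigenSeries, Derivation.leibniz, Derivation.leibniz_pow,
      Derivation.leibniz_pow]
    simp only [smul_eq_mul, nsmul_eq_mul, map_natCast]
    have h₁ := derivative_pairedSeries
    have h₂ := derivative_singleSeries
    cases a with
    | zero =>
      cases b with
      | zero => simp
      | succ b =>
        simp only [Nat.add_sub_cancel]
        push_cast
        linear_combination (-((b : PowerSeries ℝ) + 1) * pairedSeries ^ b) * h₁
    | succ a =>
      cases b with
      | zero =>
        simp only [Nat.add_sub_cancel]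
        push_cast
        linear_combination (-((a : PowerSeries ℝ) + 1) * singleSeries ^ a) * h₂
      | succ b =>
        simp only [Nat.add_sub_cancel]
        push_cast
        linear_combination
          (-((b : PowerSeries ℝ) + 1) * pairedSeries ^ b * singleSeries ^ (a + 1)) * h₁ +
          (-((a : PowerSeries ℝ) + 1) * singleSeries ^ a * pairedSeries ^ (b + 1)) * h₂
  have h' := congrArg (coeff r) h
  rw [coeff_C_mul_X_mul_derivative, map_add, coeff_C_mul, coeff_C_mul, map_sub, map_sub] at h'
  rw [generator, smul_eq_mul, smul_eq_mul, h']
  ring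

/-- The mean of an eigenfunction of `generator`. -/
lemma mean_of_generator_eq {x : ℝ} {f : ℕ → ℕ → ℝ} (h : ∀ a b, generator f a b = x * f a b)
    (n : ℕ) : mean n f = risingProd x n * f 1 0 := by
  induction n with
  | zero => rw [mean_zero, risingProd_zero, one_mul]
  | succ n ih =>
    have : generator f = fun a b => x * f a b := by ext a b; exact h a b
    rw [mean_succ, this, mean_const_mul, ih, risingProd_succ, smul_eq_mul]
    push_cast
    field_simp

lemma mean_coeff_eigenSeries (r n : ℕ) :
    mean n (fun a b => coeff r (eigenSeries a b)) =
      risingProd (r * ρ) n * ((r * ρ + 1) * limitCoeff r) := by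
  rw [mean_of_generator_eq (generator_coeff_eigenSeries r) n]
  simp [eigenSeries, singleSeries]

end SPNetwork

/-! ### Values of real power series -/

section evalSeries

open PowerSeries

variable {𝕜 : Type*} [RCLike 𝕜]

/-- The sum of a real power series at a point. -/
noncomputable def evalSeries (p : PowerSeries ℝ) (s : 𝕜) : 𝕜 :=
  ∑' r, ((coeff r p : ℝ) : 𝕜) * s ^ r

/-- Absolute convergence of a real power series at a point. -/
def AbsConvergent (p : PowerSeries ℝ) (s : 𝕜) : Prop :=
  Summable fun r => ‖((coeff r p : ℝ) : 𝕜) * s ^ r‖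

lemma AbsConvergent.hasSum {p : PowerSeries ℝ} {s : 𝕜} (h : AbsConvergent p s) :
    HasSum (fun r => ((coeff r p : ℝ) : 𝕜) * s ^ r) (evalSeries p s) :=
  (Summable.of_norm h).hasSum

lemma coeff_mul_mul_pow (p q : PowerSeries ℝ) (s : 𝕜) (r : ℕ) :
    ((coeff r (p * q) : ℝ) : 𝕜) * s ^ r =
      ∑ k ∈ Finset.HasAntidiagonal.antidiagonal r,
        (((coeff k.1 p : ℝ) : 𝕜) * s ^ k.1) * (((coeff k.2 q : ℝ) : 𝕜) * s ^ k.2) := by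
  rw [coeff_mul, RCLike.ofReal_sum, Finset.sum_mul]
  refine Finset.sum_congr rfl fun k hk => ?_
  rw [← Finset.HasAntidiagonal.mem_antidiagonal.1 hk, pow_add, RCLike.ofReal_mul]
  ring

lemma AbsConvergent.mul {p q : PowerSeries ℝ} {s : 𝕜} (hp : AbsConvergent p s)
    (hq : AbsConvergent q s) : AbsConvergent (p * q) s := by
  simpa only [AbsConvergent, coeff_mul_mul_pow] using
    summable_norm_sum_mul_antidiagonal_of_summable_norm hp hq

lemma evalSeries_mul {p q : PowerSeries ℝ} {s : 𝕜} (hp : AbsConvergent p s)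
    (hq : AbsConvergent q s) : evalSeries (p * q) s = evalSeries p s * evalSeries q s := by
  simpa only [evalSeries, coeff_mul_mul_pow] using
    (tsum_mul_tsum_eq_tsum_sum_antidiagonal_of_summable_norm hp hq).symm

lemma AbsConvergent.one (s : 𝕜) : AbsConvergent 1 s :=
  summable_of_ne_finset_zero (s := {0}) fun r hr => by
    simp [coeff_one, Finset.notMem_singleton.1 hr]

lemma evalSeries_one (s : 𝕜) : evalSeries 1 s = 1 := by
  rw [evalSeries, tsum_eq_single 0 fun r hr => by simp [coeff_one, hr]]
  simp

lemma AbsConvergent.pow {p : PowerSeries ℝ} {s : 𝕜} (hp : AbsConvergent p s) (n : ℕ) :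
    AbsConvergent (p ^ n) s ∧ evalSeries (p ^ n) s = evalSeries p s ^ n := by
  induction n with
  | zero => simp [AbsConvergent.one, evalSeries_one]
  | succ n ih => rw [pow_succ, pow_succ, evalSeries_mul ih.1 hp, ih.2]; exact ⟨ih.1.mul hp, rfl⟩

lemma summable_succ_pow_mul_geometric (k : ℕ) {q : ℝ} (hq : 0 ≤ q) (hq' : q < 1) :
    Summable fun r : ℕ => ((r : ℝ) + 1) ^ k * q ^ r := by
  rcases hq.eq_or_lt with rfl | hq
  · exact summable_of_ne_finset_zero (s := {0}) fun r hr => by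
      simp [Finset.notMem_singleton.1 hr]
  · have h := summable_pow_mul_geometric_of_norm_lt_one (R := ℝ) k (r := q)
      (by rwa [Real.norm_of_nonneg hq.le])
    have h' := ((summable_nat_add_iff 1).2 h).mul_right q⁻¹
    refine h'.congr fun r => ?_
    rw [pow_succ]
    push_cast
    field_simp

lemma AbsConvergent.of_coeff_le {p : PowerSeries ℝ} (hp : ∀ r, |coeff r p| ≤ r + 1) {s : 𝕜}
    (hs : ‖s‖ < 1) : AbsConvergent p s := by
  refine Summable.of_nonneg_of_le (fun _ => norm_nonneg _) (fun r => ?_)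
    (summable_succ_pow_mul_geometric 1 (norm_nonneg s) hs)
  rw [norm_mul, norm_pow, RCLike.norm_ofReal, pow_one]
  gcongr
  exact hp r

lemma exists_norm_evalSeries_sub_le {p : PowerSeries ℝ} (hp : ∀ r, |coeff r p| ≤ r + 1)
    (h₀ : coeff 0 p = 1) :
    ∃ K : ℝ, 0 ≤ K ∧ ∀ s : 𝕜, ‖s‖ ≤ 1 / 2 →
      ‖evalSeries p s - 1 - ((coeff 1 p : ℝ) : 𝕜) * s‖ ≤ K * ‖s‖ ^ 2 := by
  have hK : Summable fun r : ℕ => ((r : ℝ) + 2 + 1) * (1 / 2) ^ r := by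
    have h := (summable_nat_add_iff 2).2
      (summable_succ_pow_mul_geometric 1 (q := 1 / 2) (by norm_num) (by norm_num))
    refine (h.mul_right 4).congr fun r => ?_
    push_cast
    ring
  refine ⟨∑' r : ℕ, ((r : ℝ) + 2 + 1) * (1 / 2) ^ r, tsum_nonneg fun r => by positivity,
    fun s hs => ?_⟩
  have h := (AbsConvergent.of_coeff_le hp (hs.trans_lt (by norm_num))).hasSum
  have h' := (hasSum_nat_add_iff' 2).2 h
  simp only [Finset.sum_range_succ, Finset.sum_range_zero, h₀, RCLike.ofReal_one, pow_zero, pow_one,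
    mul_one, zero_add, ← sub_sub] at h'
  refine h'.norm_le_of_bounded (hK.hasSum.mul_right (‖s‖ ^ 2)) fun r => ?_
  rw [norm_mul, norm_pow, RCLike.norm_ofReal, pow_add, ← mul_assoc]
  gcongr
  simpa using hp (r + 2)

end evalSeries

lemma norm_pow_sub_pow_le {R : Type*} [NormedCommRing R] [NormOneClass R] {x y : R} {M δ : ℝ}
    (hM : 1 ≤ M) (hx : ‖x‖ ≤ M) (hy : ‖y‖ ≤ M) (h : ‖x - y‖ ≤ δ) (n : ℕ) :
    ‖x ^ n - y ^ n‖ ≤ n * δ * M ^ n := by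
  have hδ : 0 ≤ δ := (norm_nonneg _).trans h
  induction n with
  | zero => simp
  | succ n ih =>
    have h₁ : x ^ (n + 1) - y ^ (n + 1) = x ^ n * (x - y) + (x ^ n - y ^ n) * y := by ring
    rw [h₁]
    calc _ ≤ ‖x ^ n * (x - y)‖ + ‖(x ^ n - y ^ n) * y‖ := norm_add_le _ _
      _ ≤ ‖x ^ n‖ * ‖x - y‖ + ‖x ^ n - y ^ n‖ * ‖y‖ := by gcongr <;> exact norm_mul_le _ _
      _ ≤ M ^ n * δ + n * δ * M ^ n * M := by
        gcongr
        exact (norm_pow_le _ _).trans (by gcongr)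
      _ ≤ M ^ (n + 1) * δ + n * δ * M ^ n * M := by
        gcongr
        omega
      _ = _ := by push_cast; ring

lemma norm_pow_mul_pow_sub_le {R : Type*} [NormedCommRing R] [NormOneClass R]
    {x₁ x₂ y₁ y₂ : R} {M δ : ℝ} (hM : 1 ≤ M) (hx₁ : ‖x₁‖ ≤ M) (hx₂ : ‖x₂‖ ≤ M) (hy₁ : ‖y₁‖ ≤ M)
    (hy₂ : ‖y₂‖ ≤ M) (h₁ : ‖x₁ - y₁‖ ≤ δ) (h₂ : ‖x₂ - y₂‖ ≤ δ) (a b : ℕ) :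
    ‖x₁ ^ a * x₂ ^ b - y₁ ^ a * y₂ ^ b‖ ≤ (a + b : ℕ) * δ * M ^ (a + b) := by
  have hδ : 0 ≤ δ := (norm_nonneg _).trans h₁
  have h : x₁ ^ a * x₂ ^ b - y₁ ^ a * y₂ ^ b =
    x₁ ^ a * (x₂ ^ b - y₂ ^ b) + (x₁ ^ a - y₁ ^ a) * y₂ ^ b := by ring
  rw [h]
  calc _ ≤ ‖x₁ ^ a * (x₂ ^ b - y₂ ^ b)‖ + ‖(x₁ ^ a - y₁ ^ a) * y₂ ^ b‖ := norm_add_le _ _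
    _ ≤ ‖x₁ ^ a‖ * ‖x₂ ^ b - y₂ ^ b‖ + ‖x₁ ^ a - y₁ ^ a‖ * ‖y₂ ^ b‖ := by
      gcongr <;> exact norm_mul_le _ _
    _ ≤ M ^ a * (b * δ * M ^ b) + (a * δ * M ^ a) * M ^ b := by
      gcongr
      · exact (norm_pow_le _ _).trans (by gcongr)
      · exact norm_pow_sub_pow_le hM hx₂ hy₂ h₂ b
      · exact norm_pow_sub_pow_le hM hx₁ hy₁ h₁ a
      · exact (norm_pow_le _ _).trans (by gcongr)
    _ = _ := by push_cast; ring

/-! ### Means of the evaluated eigenfunctions and their limit. -/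

namespace SPNetwork

open PowerSeries

local notation "ρ" => growthRate

lemma coeff_pairedSeries_mem (r : ℕ) : coeff r pairedSeries ∈ Set.Icc (0 : ℝ) (r + 1) := by
  rw [pairedSeries, coeff_mk]
  exact ⟨(limitCoeff_mem r).1, (limitCoeff_mem r).2.trans (by simp)⟩

lemma coeff_singleSeries_mem (r : ℕ) : coeff r singleSeries ∈ Set.Icc (0 : ℝ) (r + 1) := by
  rw [singleSeries, coeff_mk]
  have h := limitCoeff_mem r
  have h₁ := growthRate_pos
  have h₂ : ρ ≤ 1 := by linarith [growthRate_lt]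
  refine ⟨mul_nonneg (by positivity) h.1, ?_⟩
  calc _ ≤ ((r : ℝ) * 1 + 1) * 1 := by
        gcongr
        · exact h.1
        · exact h.2
    _ = _ := by ring

lemma abs_coeff_pairedSeries_le (r : ℕ) : |coeff r pairedSeries| ≤ r + 1 := by
  rw [abs_of_nonneg (coeff_pairedSeries_mem r).1]; exact (coeff_pairedSeries_mem r).2

lemma abs_coeff_singleSeries_le (r : ℕ) : |coeff r singleSeries| ≤ r + 1 := by
  rw [abs_of_nonneg (coeff_singleSeries_mem r).1]; exact (coeff_singleSeries_mem r).2

variable {𝕜 : Type*} [RCLike 𝕜]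

lemma hasSum_eigenSeries {s : 𝕜} (hs : ‖s‖ < 1) (a b : ℕ) :
    HasSum (fun r => ((coeff r (eigenSeries a b) : ℝ) : 𝕜) * s ^ r)
      (evalSeries singleSeries s ^ a * evalSeries pairedSeries s ^ b) := by
  have h₁ := (AbsConvergent.of_coeff_le abs_coeff_singleSeries_le hs).pow a
  have h₂ := (AbsConvergent.of_coeff_le abs_coeff_pairedSeries_le hs).pow b
  rw [← h₁.2, ← h₂.2, ← evalSeries_mul h₁.1 h₂.1]
  exact (h₁.1.mul h₂.1).hasSum

lemma hasSum_mean_eigenSeries {s : 𝕜} (hs : ‖s‖ < 1) (n : ℕ) :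
    HasSum (fun r : ℕ =>
      ((risingProd (r * ρ) n * ((r * ρ + 1) * limitCoeff r) : ℝ) : 𝕜) * s ^ r)
      (mean n fun a b => evalSeries singleSeries s ^ a * evalSeries pairedSeries s ^ b) := by
  refine (hasSum_mean n fun a b => hasSum_eigenSeries hs a b).congr_fun fun r => ?_
  have h : (fun a b => ((coeff r (eigenSeries a b) : ℝ) : 𝕜) * s ^ r) =
      fun a b => s ^ r * ((coeff r (eigenSeries a b) : ℝ) : 𝕜) := by ext a b; ring
  rw [h, mean_const_mul, mean_ofReal, mean_coeff_eigenSeries, mul_comm]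

/-- The moment of order `r` of the limit law, divided by `r!`. -/
noncomputable def limitMomentDiv (r : ℕ) : ℝ :=
  (r * ρ + 1) * limitCoeff r / Real.Gamma (r * ρ + 1)

lemma limitMomentDiv_nonneg (r : ℕ) : 0 ≤ limitMomentDiv r := by
  have h₁ := growthRate_pos
  exact div_nonneg (mul_nonneg (by positivity) (limitCoeff_mem r).1)
    (Real.Gamma_pos_of_pos (by positivity)).le

/-- Dominating series for every `T`: taking `N` with `N ^ ρ > |T|` in `risingProd_div_rpow_le`
leaves a polynomial in `r` times a convergent geometric term. -/
lemma exists_summable_bound (T : ℝ) :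
    ∃ bound : ℕ → ℝ, Summable bound ∧ ∃ N : ℕ, ∀ n ≥ N, ∀ r : ℕ,
      risingProd (r * ρ) n / ((n : ℝ) + 1) ^ (r * ρ) * ((r * ρ + 1) * limitCoeff r) * |T| ^ r ≤
        bound r := by
  have hρ := growthRate_pos
  have hρ₁ : ρ ≤ 1 := by linarith [growthRate_lt]
  have h := (tendsto_rpow_atTop hρ).comp tendsto_natCast_atTop_atTop
  obtain ⟨N, hN⟩ := ((h.eventually_gt_atTop |T|).and (eventually_ge_atTop 1)).exists
  have hN₁ : |T| < (N : ℝ) ^ ρ := hN.1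
  have hN₂ : (0 : ℝ) < N := by exact_mod_cast hN.2
  have hN₃ : 0 < (N : ℝ) ^ ρ := by positivity
  refine ⟨fun r => ((r : ℝ) + 1) ^ (N + 1) * (|T| / (N : ℝ) ^ ρ) ^ r,
    summable_succ_pow_mul_geometric _ (by positivity) ((div_lt_one hN₃).2 hN₁), N,
    fun n hn r => ?_⟩
  have h₁ := risingProd_div_rpow_le (x := r * ρ) (by positivity) hN.2 hn
  have h₂ := limitCoeff_mem r
  have h₃ : (r : ℝ) * ρ ≤ r := mul_le_of_le_one_right (by positivity) hρ₁
  have h₄ : (N : ℝ) ^ (r * ρ) = ((N : ℝ) ^ ρ) ^ r := by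
    rw [mul_comm, Real.rpow_mul hN₂.le, Real.rpow_natCast]
  calc _ ≤ (1 + r * ρ) ^ N / (N : ℝ) ^ (r * ρ) * ((r * ρ + 1) * 1) * |T| ^ r := by
        gcongr
        · exact mul_nonneg (by positivity) h₂.1
        · exact h₂.2
    _ = (r * ρ + 1) ^ (N + 1) * (|T| / (N : ℝ) ^ ρ) ^ r := by
      rw [h₄, div_pow]; ring
    _ ≤ ((r : ℝ) + 1) ^ (N + 1) * (|T| / (N : ℝ) ^ ρ) ^ r := by gcongr

lemma tendsto_term (r : ℕ) :
    Tendsto (fun n : ℕ => risingProd (r * ρ) n / ((n : ℝ) + 1) ^ (r * ρ) *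
      ((r * ρ + 1) * limitCoeff r)) atTop (𝓝 (limitMomentDiv r)) := by
  have h := (tendsto_risingProd_div_rpow (x := r * ρ)
    (mul_nonneg (Nat.cast_nonneg r) growthRate_pos.le)).mul_const ((r * ρ + 1) * limitCoeff r)
  rwa [one_div_mul_eq_div] at h

lemma summable_limitMomentDiv (T : ℝ) : Summable fun r => limitMomentDiv r * |T| ^ r := by
  obtain ⟨bound, hb, N, hN⟩ := exists_summable_bound T
  refine Summable.of_nonneg_of_le
    (fun r => mul_nonneg (limitMomentDiv_nonneg r) (by positivity)) (fun r => ?_) hb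
  refine le_of_tendsto ((tendsto_term r).mul_const _) ?_
  filter_upwards [eventually_ge_atTop N] with n hn using hN n hn r

/-- The scale `(n + 1) ^ ρ` of the network with `n + 1` edges. -/
noncomputable def scale (n : ℕ) : ℝ := ((n : ℝ) + 1) ^ ρ

lemma scale_pos (n : ℕ) : 0 < scale n := by unfold scale; positivity

lemma tendsto_scale : Tendsto scale atTop atTop :=
  (tendsto_rpow_atTop growthRate_pos).comp
    (tendsto_natCast_atTop_atTop.atTop_add tendsto_const_nhds)

lemma tendsto_const_div_scale (t : ℝ) : Tendsto (fun n => t / scale n) atTop (𝓝 0) :=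
  tendsto_scale.const_div_atTop t

/-- Dominated convergence over `r`: the power `scale n ^ r` is exactly the normalisation `(n + 1) ^
(r ρ)` of `risingProd (r ρ) n`. -/
lemma tendsto_mean_eigenSeries (t : 𝕜) :
    Tendsto (fun n => mean n fun a b => evalSeries singleSeries (t / (scale n : 𝕜)) ^ a *
        evalSeries pairedSeries (t / (scale n : 𝕜)) ^ b) atTop
      (𝓝 (∑' r, (limitMomentDiv r : 𝕜) * t ^ r)) := by
  obtain ⟨bound, hb, N, hN⟩ := exists_summable_bound ‖t‖
  have hρ := growthRate_pos
  have key : ∀ n r : ℕ, ((risingProd (r * ρ) n * ((r * ρ + 1) * limitCoeff r) : ℝ) : 𝕜) *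
      (t / (scale n : 𝕜)) ^ r = ((risingProd (r * ρ) n / ((n : ℝ) + 1) ^ (r * ρ) *
      ((r * ρ + 1) * limitCoeff r) : ℝ) : 𝕜) * t ^ r := fun n r => by
    have h₁ : ((n : ℝ) + 1) ^ (r * ρ) = scale n ^ r := by
      rw [scale, mul_comm, Real.rpow_mul (by positivity), Real.rpow_natCast]
    have h₂ : (scale n : 𝕜) ≠ 0 := by exact_mod_cast (scale_pos n).ne'
    rw [h₁, div_pow]
    push_cast
    field_simp
  have h₁ : Tendsto (fun n => ∑' r : ℕ, ((risingProd (r * ρ) n / ((n : ℝ) + 1) ^ (r * ρ) *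
      ((r * ρ + 1) * limitCoeff r) : ℝ) : 𝕜) * t ^ r) atTop
      (𝓝 (∑' r, (limitMomentDiv r : 𝕜) * t ^ r)) := by
    refine tendsto_tsum_of_dominated_convergence hb (fun r => ?_) ?_
    · exact ((RCLike.continuous_ofReal.tendsto _).comp (tendsto_term r)).mul_const _
    · filter_upwards [eventually_ge_atTop N] with n hn r
      have h := hN n hn r
      rw [abs_of_nonneg (norm_nonneg t)] at h
      rw [norm_mul, norm_pow, RCLike.norm_ofReal, abs_of_nonneg]
      · exact h
      · have := (risingProd_pos (x := r * ρ) (by positivity) n).le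
        have := (limitCoeff_mem r).1
        positivity
  refine h₁.congr' ?_
  filter_upwards [(tendsto_const_div_scale ‖t‖).eventually_lt_const one_pos] with n hn
  have hs : ‖t / (scale n : 𝕜)‖ < 1 := by
    rwa [norm_div, RCLike.norm_ofReal, abs_of_pos (scale_pos n)]
  rw [← (hasSum_mean_eigenSeries hs n).tsum_eq]
  exact tsum_congr fun r => (key n r).symm

end SPNetwork

namespace SPNetwork

open PowerSeries

local notation "ρ" => growthRate

/-! ### Means of linear and quadratic functions -/

/-- Truncated subtraction is harmless: it differs from real subtraction only where the prefactor `a`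
or `b` vanishes. -/
lemma generator_cast (g : ℝ → ℝ → ℝ) (a b : ℕ) :
    generator (fun a b : ℕ => g a b) a b =
      a * (g (a - 1) (b + 2) - g a b) + b * (g (a + 1) (b - 1) - g a b) := by
  unfold generator
  rcases a with _ | a <;> rcases b with _ | b <;> simp

/-- The linear eigenfunction of `generator` with the positive eigenvalue. -/
noncomputable def leadingForm (a b : ℕ) : ℝ := √2 * a + b

/-- The linear eigenfunction of `generator` with the negative eigenvalue. -/
noncomputable def decayingForm (a b : ℕ) : ℝ := b - √2 * a

lemma sqrt_two_sq : √2 ^ 2 = (2 : ℝ) := Real.sq_sqrt (by norm_num)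

lemma mean_leadingForm (n : ℕ) : mean n leadingForm = √2 * risingProd ρ n := by
  rw [mean_of_generator_eq (x := ρ) (f := leadingForm) fun a b => ?_]
  · simp [leadingForm, mul_comm]
  · have := generator_cast (fun a b => √2 * a + b) a b
    unfold leadingForm
    rw [this, growthRate]
    linear_combination (-a : ℝ) * sqrt_two_sq

lemma mean_decayingForm (n : ℕ) : mean n decayingForm = -(√2 * risingProd (-1 - √2) n) := by
  rw [mean_of_generator_eq (x := -1 - √2) (f := decayingForm) fun a b => ?_]
  · simp [decayingForm, mul_comm]
  · have := generator_cast (fun a b => b - √2 * a) a b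
    unfold decayingForm
    rw [this]
    linear_combination (-a : ℝ) * sqrt_two_sq

/-- The coefficient of `leadingForm` is `c_1`; this fixes the free parameter of the series so that
the limit is that of `a + b` itself. -/
lemma add_eq_forms (a b : ℕ) :
    ((a + b : ℕ) : ℝ) = (1 + √2) / (2 * √2) * leadingForm a b +
      (√2 - 1) / (2 * √2) * decayingForm a b := by
  rw [leadingForm, decayingForm]
  push_cast
  field_simp
  ring

lemma mean_add_eq (n : ℕ) :
    mean n (fun a b => ((a + b : ℕ) : ℝ)) =
      (1 + √2) / 2 * risingProd ρ n - (√2 - 1) / 2 * risingProd (-1 - √2) n := by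
  simp only [add_eq_forms]
  rw [mean_add, mean_const_mul n _ leadingForm, mean_const_mul n _ decayingForm, mean_leadingForm,
    mean_decayingForm]
  field_simp
  ring

lemma mean_le_of_generator_nonpos {f : ℕ → ℕ → ℝ} (h : ∀ a b, generator f a b ≤ 0) (n : ℕ) :
    mean n f ≤ f 1 0 := by
  induction n with
  | zero => rw [mean_zero]
  | succ n ih =>
    have h₁ : mean n (generator f) ≤ 0 := (mean_mono n h).trans_eq (mean_const n 0)
    have h₂ : ((n + 1 : ℕ) : ℝ)⁻¹ • mean n (generator f) ≤ 0 :=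
      mul_nonpos_of_nonneg_of_nonpos (by positivity) h₁
    rw [mean_succ]
    linarith

/-- The square contracts, apart from squared jumps `(2 + √2) ^ 2` and `(1 + √2) ^ 2` at rates `a`
and `b`. Subtracting `12 / ρ * leadingForm` adds the drift `-12 (√2 a + b)`, which outweighs them.
-/
lemma mean_decayingForm_sq_le (n : ℕ) :
    mean n (fun a b => decayingForm a b ^ 2) ≤ 2 + 12 / ρ * (√2 * risingProd ρ n) := by
  have hρ := growthRate_pos
  have h2 := sqrt_two_sq
  have hs : √2 ≤ 3 / 2 := by nlinarith [Real.sqrt_nonneg 2]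
  have hs' : 1 ≤ √2 := by nlinarith [Real.sqrt_nonneg 2]
  have h := mean_le_of_generator_nonpos (f := fun a b => decayingForm a b ^ 2 - 12 / ρ * leadingForm a b)
    (fun a b => ?_) n
  · rw [mean_sub, mean_const_mul n (12 / ρ) leadingForm, mean_leadingForm] at h
    have h₁ : decayingForm 1 0 ^ 2 - 12 / ρ * leadingForm 1 0 ≤ 2 := by
      have : 0 ≤ 12 / ρ * leadingForm 1 0 := by unfold leadingForm; positivity
      have : decayingForm 1 0 ^ 2 = 2 := by simp [decayingForm]
      linarith
    linarith
  · have hc := generator_cast (fun a b => (b - √2 * a) ^ 2 - 12 / ρ * (√2 * a + b)) a b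
    unfold decayingForm leadingForm
    rw [hc]
    have hρ' : 12 / ρ * (√2 - 1) = 12 := by rw [← growthRate]; field_simp
    have : (a : ℝ) * ((b + 2 - √2 * (a - 1)) ^ 2 - 12 / ρ * (√2 * (a - 1) + (b + 2)) -
          ((b - √2 * a) ^ 2 - 12 / ρ * (√2 * a + b))) +
        b * ((b - 1 - √2 * (a + 1)) ^ 2 - 12 / ρ * (√2 * (a + 1) + (b - 1)) -
          ((b - √2 * a) ^ 2 - 12 / ρ * (√2 * a + b))) =
        -(2 * (1 + √2) * (b - √2 * a) ^ 2) + a * ((2 + √2) ^ 2 - 12 * √2) +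
          b * ((1 + √2) ^ 2 - 12) := by
      linear_combination (-(√2 * a) - b) * hρ' +
        (2 * √2 * a ^ 2 - 2 * a * b + 12 / ρ * a) * h2
    rw [this]
    have h₃ : (2 + √2) ^ 2 - 12 * √2 ≤ 0 := by nlinarith
    have h₄ : (1 + √2) ^ 2 - 12 ≤ 0 := by nlinarith
    have h₅ : 0 ≤ 2 * (1 + √2) * (b - √2 * a) ^ 2 := by positivity
    have h₆ := mul_nonpos_of_nonneg_of_nonpos (Nat.cast_nonneg a : (0 : ℝ) ≤ a) h₃
    have h₇ := mul_nonpos_of_nonneg_of_nonpos (Nat.cast_nonneg b : (0 : ℝ) ≤ b) h₄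
    linarith

lemma tendsto_risingProd_div_scale :
    Tendsto (fun n => risingProd ρ n / scale n) atTop (𝓝 (1 / Real.Gamma √2)) := by
  have h := tendsto_risingProd_div_rpow growthRate_pos.le
  rwa [← sqrt_two_eq] at h

lemma tendsto_mean_abs_decayingForm :
    Tendsto (fun n => mean n (fun a b => |decayingForm a b|) / scale n) atTop (𝓝 0) := by
  have h₁ : Tendsto (fun n => (2 / scale n + 12 / ρ * (√2 * (risingProd ρ n / scale n)) + 1) / 2 *
      (1 / √(scale n))) atTop
      (𝓝 ((0 + 12 / ρ * (√2 * (1 / Real.Gamma √2)) + 1) / 2 * 0)) := by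
    refine Tendsto.mul ((((tendsto_const_div_scale 2).add
      ((tendsto_risingProd_div_scale.const_mul _).const_mul _)).add_const 1).div_const 2) ?_
    exact (Real.tendsto_sqrt_atTop.comp tendsto_scale).const_div_atTop 1
  rw [mul_zero] at h₁
  refine squeeze_zero (fun n => ?_) (fun n => ?_) h₁
  · exact div_nonneg (mean_nonneg n fun a b => abs_nonneg _) (scale_pos n).le
  -- Since the second moment is of order `scale n = q ^ 2`, the inequality `|d| ≤ d ^ 2 / (2 q) + q
  -- / 2` bounds the mean of `|d|` by a multiple of `q`.
  · set q := √(scale n) with hq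
    have hq₀ : 0 < q := Real.sqrt_pos.2 (scale_pos n)
    have hq₂ : scale n = q ^ 2 := (Real.sq_sqrt (scale_pos n).le).symm
    have h₂ : mean n (fun a b => |decayingForm a b|) ≤
        mean n (fun a b => 1 / (2 * q) * decayingForm a b ^ 2 + q / 2) := by
      refine mean_mono n fun a b => ?_
      have h := sq_nonneg (|decayingForm a b| - q)
      rw [← sq_abs (decayingForm a b), ← sub_nonneg]
      have : 1 / (2 * q) * |decayingForm a b| ^ 2 + q / 2 - |decayingForm a b| =
          1 / (2 * q) * (|decayingForm a b| - q) ^ 2 := by field_simp; ring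
      rw [this]
      positivity
    rw [mean_add, mean_const_mul, mean_const] at h₂
    have h₃ := mean_decayingForm_sq_le n
    rw [div_le_iff₀ (scale_pos n), hq₂]
    calc _ ≤ 1 / (2 * q) * (2 + 12 / ρ * (√2 * risingProd ρ n)) + q / 2 := by
          refine h₂.trans ?_
          gcongr
      _ = _ := by field_simp

/-! ### Exponential moments -/

lemma one_add_le_evalSeries {p : PowerSeries ℝ} (hp : ∀ r : ℕ, coeff r p ∈ Set.Icc (0 : ℝ) (r + 1))
    (h₀ : coeff 0 p = 1) {s : ℝ} (hs : 0 ≤ s) (hs' : s < 1) :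
    1 + coeff 1 p * s ≤ evalSeries p s := by
  have h := (AbsConvergent.of_coeff_le (p := p) (s := s)
    (fun r => by rw [abs_of_nonneg (hp r).1]; exact (hp r).2)
    (by rwa [Real.norm_of_nonneg hs])).hasSum
  refine le_trans (le_of_eq ?_) (sum_le_hasSum (Finset.range 2) (fun r _ => ?_) h)
  · simp [Finset.sum_range_succ, h₀]
  · exact mul_nonneg (hp r).1 (by positivity)

lemma coeff_zero_pairedSeries : coeff 0 pairedSeries = 1 := by
  rw [pairedSeries, coeff_mk, limitCoeff]

lemma coeff_zero_singleSeries : coeff 0 singleSeries = 1 := by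
  rw [singleSeries, coeff_mk, limitCoeff]; simp

lemma coeff_one_pairedSeries : coeff 1 pairedSeries = limitCoeff 1 := by
  rw [pairedSeries, coeff_mk]

lemma coeff_one_singleSeries : coeff 1 singleSeries = √2 * limitCoeff 1 := by
  rw [singleSeries, coeff_mk, sqrt_two_eq]; simp

/-- As the coefficients are nonnegative, each factor `1 + τ / scale n` is at most the value of
either series at `T / scale n`, so the convergent means of the eigenfunctions dominate. -/
lemma exists_mean_one_add_pow_le {τ : ℝ} (hτ : 0 ≤ τ) :
    ∃ C, ∀ᶠ n in atTop, mean n (fun a b => (1 + τ / scale n) ^ (a + b)) ≤ C := by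
  have hc := limitCoeff_one_pos
  set T := τ / limitCoeff 1 with hT
  have hT₀ : 0 ≤ T := by positivity
  obtain ⟨L, h⟩ : ∃ L, Tendsto _ atTop (𝓝 L) := ⟨_, tendsto_mean_eigenSeries (𝕜 := ℝ) T⟩
  refine ⟨L + 1, ?_⟩
  filter_upwards [h.eventually_le_const (lt_add_one _),
    (tendsto_const_div_scale T).eventually_lt_const one_pos] with n hn hn'
  refine le_trans (mean_mono n fun a b => ?_) hn
  have hs : 0 ≤ T / scale n := div_nonneg hT₀ (scale_pos n).le
  have h₁ : 1 + τ / scale n = 1 + limitCoeff 1 * (T / scale n) := by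
    rw [hT]; field_simp
  have h₂ := one_add_le_evalSeries coeff_pairedSeries_mem coeff_zero_pairedSeries hs hn'
  have h₃ := one_add_le_evalSeries coeff_singleSeries_mem coeff_zero_singleSeries hs hn'
  rw [coeff_one_pairedSeries] at h₂
  rw [coeff_one_singleSeries] at h₃
  have h₄ : 1 + τ / scale n ≤ 1 + √2 * limitCoeff 1 * (T / scale n) := by
    rw [h₁]
    gcongr
    have : (1 : ℝ) ≤ √2 := by rw [sqrt_two_eq]; linarith [growthRate_pos]
    exact le_mul_of_one_le_left hc.le this
  have h₅ : 0 ≤ 1 + τ / scale n := by have := scale_pos n; positivity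
  rw [pow_add]
  refine mul_le_mul (pow_le_pow_left₀ h₅ (h₄.trans h₃) a)
    (pow_le_pow_left₀ h₅ (h₁.le.trans h₂) b) (by positivity) ?_
  exact pow_nonneg (h₅.trans (h₄.trans h₃)) a

lemma exists_mean_exp_le {τ : ℝ} (hτ : 0 ≤ τ) :
    ∃ C, ∀ᶠ n in atTop, mean n (fun a b => Real.exp (τ * (((a + b : ℕ) : ℝ) / scale n))) ≤ C := by
  -- The factor `2` comes from `exp x ≤ 1 + 2 x` on `[0, 1]`.
  obtain ⟨C, hC⟩ := exists_mean_one_add_pow_le (τ := 2 * τ) (by positivity)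
  refine ⟨C, ?_⟩
  filter_upwards [hC, (tendsto_const_div_scale τ).eventually_lt_const one_pos] with n hn hn'
  refine le_trans (mean_mono n fun a b => ?_) hn
  have hs : 0 ≤ τ / scale n := div_nonneg hτ (scale_pos n).le
  have h₁ : τ * (((a + b : ℕ) : ℝ) / scale n) = (a + b : ℕ) * (τ / scale n) := by ring
  rw [h₁, Real.exp_nat_mul]
  gcongr
  have h₂ := (abs_le.1 (Real.abs_exp_sub_one_sub_id_le (x := τ / scale n)
    (by rw [abs_of_nonneg hs]; exact hn'.le))).2
  have h₃ : (τ / scale n) ^ 2 ≤ τ / scale n := by nlinarith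
  rw [mul_div_assoc]
  linarith

/-! ### Convergence of the characteristic functions -/

lemma exists_bounds_evalSeries {p : PowerSeries ℝ} (hp : ∀ r, |coeff r p| ≤ r + 1)
    (h₀ : coeff 0 p = 1) :
    ∃ K : ℝ, 0 ≤ K ∧ ∀ s : ℂ, ‖s‖ ≤ 1 / 2 →
      ‖Complex.exp ((coeff 1 p : ℝ) * s) - evalSeries p s‖ ≤ K * ‖s‖ ^ 2 ∧
      ‖evalSeries p s‖ ≤ 1 + K * ‖s‖ := by
  obtain ⟨K, hK, h⟩ := exists_norm_evalSeries_sub_le (𝕜 := ℂ) hp h₀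
  have hp₁ : |coeff 1 p| ≤ 2 := (hp 1).trans (by norm_num)
  refine ⟨K + 4, by positivity, fun s hs => ⟨?_, ?_⟩⟩
  · have h₁ : ‖((coeff 1 p : ℝ) : ℂ) * s‖ ≤ 2 * ‖s‖ := by
      rw [norm_mul, Complex.norm_real, Real.norm_eq_abs]
      gcongr
    have h₂ := Complex.norm_exp_sub_one_sub_id_le (x := ((coeff 1 p : ℝ) : ℂ) * s)
      (by linarith)
    have h₃ := h s hs
    calc _ = ‖(Complex.exp ((coeff 1 p : ℝ) * s) - 1 - ((coeff 1 p : ℝ) : ℂ) * s) -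
          (evalSeries p s - 1 - ((coeff 1 p : ℝ) : ℂ) * s)‖ := by congr 1; ring
      _ ≤ _ := norm_sub_le _ _
      _ ≤ (2 * ‖s‖) ^ 2 + K * ‖s‖ ^ 2 := by
        refine add_le_add (h₂.trans (by gcongr)) h₃
      _ = _ := by ring
  · have h₃ := h s hs
    calc _ = ‖1 + ((coeff 1 p : ℝ) : ℂ) * s +
          (evalSeries p s - 1 - ((coeff 1 p : ℝ) : ℂ) * s)‖ := by congr 1; ring
      _ ≤ ‖(1 : ℂ)‖ + ‖((coeff 1 p : ℝ) : ℂ) * s‖ + K * ‖s‖ ^ 2 :=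
        (norm_add₃_le).trans (by gcongr; exact h₃)
      _ ≤ 1 + 2 * ‖s‖ + K * ‖s‖ := by
        rw [norm_mul, Complex.norm_real, Real.norm_eq_abs, norm_one]
        gcongr
        nlinarith [norm_nonneg s]
      _ ≤ _ := by nlinarith [norm_nonneg s]

/-- Each of the `a + b` factors errs by `O(‖s‖ ^ 2)`; one factor `‖s‖` gives the decay, and the rest
is absorbed by an exponential moment. -/
lemma tendsto_mean_exp_leadingForm_sub (t : ℝ) :
    Tendsto (fun n => mean n fun a b =>
      Complex.exp ((limitCoeff 1 * leadingForm a b : ℝ) * (t * Complex.I / scale n)) -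
        evalSeries singleSeries (t * Complex.I / scale n) ^ a *
          evalSeries pairedSeries (t * Complex.I / scale n) ^ b) atTop (𝓝 0) := by
  obtain ⟨K₁, hK₁, h₁⟩ := exists_bounds_evalSeries abs_coeff_singleSeries_le coeff_zero_singleSeries
  obtain ⟨K₂, hK₂, h₂⟩ := exists_bounds_evalSeries abs_coeff_pairedSeries_le coeff_zero_pairedSeries
  set K := max K₁ K₂ with hK
  have hK₀ : 0 ≤ K := le_max_of_le_left hK₁
  obtain ⟨C, hC⟩ := exists_mean_one_add_pow_le (τ := (2 * K + K ^ 2) * |t|) (by positivity)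
  have hlim : Tendsto (fun n => C * (|t| / scale n)) atTop (𝓝 0) := by
    simpa using (tendsto_const_div_scale |t|).const_mul C
  refine squeeze_zero_norm' ?_ hlim
  filter_upwards [hC, (tendsto_const_div_scale |t|).eventually_lt_const (u := 1 / 2) (by norm_num)]
    with n hn hn'
  set s : ℂ := t * Complex.I / scale n with hs
  have hs' : ‖s‖ = |t| / scale n := by
    rw [hs, norm_div, norm_mul, Complex.norm_I, Complex.norm_real, Complex.norm_real, mul_one,
      Real.norm_eq_abs, Real.norm_of_nonneg (scale_pos n).le]
  have hs₀ : ‖s‖ ≤ 1 / 2 := hs' ▸ hn'.le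
  have hexp : ∀ x : ℝ, ‖Complex.exp (x * s)‖ = 1 := fun x => by
    have : (x : ℂ) * s = ((x * t / scale n : ℝ) : ℂ) * Complex.I := by
      rw [hs]; push_cast; ring
    rw [this, Complex.norm_exp_ofReal_mul_I]
  have hM : 1 ≤ 1 + K * ‖s‖ := by nlinarith [norm_nonneg s]
  refine (norm_mean_le n _).trans ?_
  calc mean n _ ≤ mean n (fun a b => ‖s‖ * (1 + (2 * K + K ^ 2) * |t| / scale n) ^ (a + b)) := by
        refine mean_mono n fun a b => ?_
        have h₃ : Complex.exp ((limitCoeff 1 * leadingForm a b : ℝ) * s) =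
            Complex.exp ((coeff 1 singleSeries : ℝ) * s) ^ a *
              Complex.exp ((coeff 1 pairedSeries : ℝ) * s) ^ b := by
          rw [← Complex.exp_nat_mul, ← Complex.exp_nat_mul, ← Complex.exp_add,
            coeff_one_singleSeries, coeff_one_pairedSeries, leadingForm]
          congr 1
          push_cast
          ring
        rw [h₃]
        have h₄ := norm_pow_mul_pow_sub_le hM ((hexp _).trans_le hM) ((hexp _).trans_le hM)
          ((h₁ s hs₀).2.trans (by gcongr; exact le_max_left _ _))
          ((h₂ s hs₀).2.trans (by gcongr; exact le_max_right _ _))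
          ((h₁ s hs₀).1.trans (mul_le_mul_of_nonneg_right (le_max_left K₁ K₂) (by positivity)))
          ((h₂ s hs₀).1.trans (mul_le_mul_of_nonneg_right (le_max_right K₁ K₂) (by positivity)))
          a b
        rw [← hK] at h₄
        refine h₄.trans ?_
        -- Bernoulli's inequality trades the linear factor `a + b` for a second power of `1 + K *
        -- ‖s‖`.
        have h₅ : ((a + b : ℕ) : ℝ) * (K * ‖s‖) ≤ (1 + K * ‖s‖) ^ (a + b) := by
          have := one_add_mul_le_pow (a := K * ‖s‖) (by nlinarith [norm_nonneg s]) (a + b)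
          linarith
        -- Source of `τ = (2 * K + K ^ 2) * |t|`, using `‖s‖ ≤ 1`.
        have h₆ : (1 + K * ‖s‖) ^ 2 ≤ 1 + (2 * K + K ^ 2) * |t| / scale n := by
          rw [mul_div_assoc, ← hs']
          nlinarith [mul_nonneg (sq_nonneg K) (mul_nonneg (norm_nonneg s)
            (sub_nonneg.2 (hs₀.trans (by norm_num : (1 / 2 : ℝ) ≤ 1))))]
        calc _ = ‖s‖ * (((a + b : ℕ) : ℝ) * (K * ‖s‖) * (1 + K * ‖s‖) ^ (a + b)) := by ring
          _ ≤ ‖s‖ * ((1 + K * ‖s‖) ^ (a + b) * (1 + K * ‖s‖) ^ (a + b)) := by gcongr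
          _ = ‖s‖ * ((1 + K * ‖s‖) ^ 2) ^ (a + b) := by rw [← mul_pow, sq]
          _ ≤ _ := by gcongr
    _ ≤ _ := by
      rw [mean_const_mul n ‖s‖ fun a b => (1 + (2 * K + K ^ 2) * |t| / scale n) ^ (a + b), hs',
        mul_comm C]
      exact mul_le_mul_of_nonneg_left hn (hs' ▸ norm_nonneg s)

/-- The exponents differ by a multiple of `decayingForm / scale n`, and `x ↦ exp (i x)` is
1-Lipschitz. -/
lemma tendsto_mean_exp_sub (t : ℝ) :
    Tendsto (fun n => mean n fun a b =>
      Complex.exp (((a + b : ℕ) : ℝ) * (t * Complex.I / scale n)) -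
      Complex.exp ((limitCoeff 1 * leadingForm a b : ℝ) * (t * Complex.I / scale n)))
      atTop (𝓝 0) := by
  have hlim : Tendsto (fun n => |t| * ((√2 - 1) / (2 * √2)) *
      (mean n (fun a b => |decayingForm a b|) / scale n)) atTop (𝓝 0) := by
    simpa using tendsto_mean_abs_decayingForm.const_mul (|t| * ((√2 - 1) / (2 * √2)))
  refine squeeze_zero_norm (fun n => ?_) hlim
  have h₀ : 0 ≤ (√2 - 1) / (2 * √2) := div_nonneg growthRate_pos.le (by positivity)
  refine (norm_mean_le n _).trans ?_
  have hcomm : ∀ x y z : ℝ, x * (y / z) = x / z * y := fun x y z => by ring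
  rw [hcomm, ← mean_const_mul n _ fun a b => |decayingForm a b|]
  refine mean_mono n fun a b => ?_
  have h₁ : ∀ x : ℝ, Complex.exp (x * (t * Complex.I / scale n)) =
      Complex.exp (Complex.I * ((x * t / scale n : ℝ) : ℂ)) := fun x => by
    congr 1; push_cast; ring
  rw [h₁, h₁]
  have h₂ : ∀ x y : ℝ, ‖Complex.exp (Complex.I * x) - Complex.exp (Complex.I * y)‖ ≤ |x - y| :=
    fun x y => by
      have h := Real.norm_exp_I_mul_ofReal_sub_one_le (x := x - y)
      have h' : Complex.exp (Complex.I * x) - Complex.exp (Complex.I * y) =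
          Complex.exp (y * Complex.I) * (Complex.exp (Complex.I * ((x - y : ℝ) : ℂ)) - 1) := by
        rw [mul_sub, ← Complex.exp_add, mul_one, mul_comm (y : ℂ)]
        congr 2
        push_cast
        ring
      rw [h', norm_mul, Complex.norm_exp_ofReal_mul_I, one_mul]
      exact h
  refine (h₂ _ _).trans (le_of_eq ?_)
  have h₃ : limitCoeff 1 = (1 + √2) / (2 * √2) := limitCoeff.eq_2
  have h₄ : ((a + b : ℕ) : ℝ) * t / scale n - limitCoeff 1 * leadingForm a b * t / scale n =
      t * ((√2 - 1) / (2 * √2)) / scale n * decayingForm a b := by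
    rw [add_eq_forms, h₃]; ring
  rw [h₄, abs_mul, abs_div, abs_mul, abs_of_nonneg h₀, abs_of_pos (scale_pos n)]

/-- The characteristic function of the limit law. -/
noncomputable def limitCharFun (t : ℝ) : ℂ :=
  ∑' r, (limitMomentDiv r : ℂ) * (t * Complex.I) ^ r

lemma tendsto_mean_exp (t : ℝ) :
    Tendsto (fun n => mean n fun a b =>
      Complex.exp (((a + b : ℕ) : ℝ) * (t * Complex.I / scale n))) atTop (𝓝 (limitCharFun t)) := by
  have h := ((tendsto_mean_exp_sub t).add (tendsto_mean_exp_leadingForm_sub t)).add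
    (tendsto_mean_eigenSeries (𝕜 := ℂ) (t * Complex.I))
  rw [zero_add, zero_add] at h
  refine h.congr fun n => ?_
  rw [← mean_add, ← mean_add]
  congr 1 with a b
  simp

end SPNetwork

/-! ### Laws with an entire characteristic function -/

lemma integrable_of_hasSum_of_nonneg {α : Type*} [MeasurableSpace α] {μ : Measure α}
    {F : ℕ → α → ℝ} {f : α → ℝ} (hF : ∀ n, Integrable (F n) μ) (hF₀ : ∀ n x, 0 ≤ F n x)
    (hs : Summable fun n => ∫ x, F n x ∂μ) (hf : ∀ x, HasSum (fun n => F n x) (f x))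
    (hm : AEStronglyMeasurable f μ) : Integrable f μ := by
  refine ⟨hm, ?_⟩
  rw [hasFiniteIntegral_iff_ofReal (ae_of_all _ fun x => (hf x).nonneg fun n => hF₀ n x)]
  have h : ∀ x, ENNReal.ofReal (f x) = ∑' n, ENNReal.ofReal (F n x) := fun x => by
    rw [← (hf x).tsum_eq, ENNReal.ofReal_tsum_of_nonneg (fun n => hF₀ n x) (hf x).summable]
  simp_rw [h]
  rw [lintegral_tsum fun n => (hF n).1.aemeasurable.ennreal_ofReal]
  have h' : ∀ n, ∫⁻ x, ENNReal.ofReal (F n x) ∂μ = ENNReal.ofReal (∫ x, F n x ∂μ) := fun n =>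
    (ofReal_integral_eq_lintegral_ofReal (hF n) (ae_of_all _ (hF₀ n))).symm
  simp_rw [h']
  rw [← ENNReal.ofReal_tsum_of_nonneg (fun n => integral_nonneg (hF₀ n)) hs]
  exact ENNReal.ofReal_lt_top

lemma hasPowerSeries_of_forall_hasSum {a : ℕ → ℂ} {f : ℝ → ℂ}
    (h : ∀ t : ℝ, HasSum (fun r => a r * (t : ℂ) ^ r) (f t)) :
    HasFPowerSeriesAt f
      (fun r => ContinuousMultilinearMap.mkPiRing ℝ (Fin r) (a r) : FormalMultilinearSeries ℝ ℝ ℂ)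
      0 := by
  refine hasFPowerSeriesAt_iff.2 (Eventually.of_forall fun t => ?_)
  rw [zero_add]
  refine (h t).congr_fun fun r => ?_
  simp [FormalMultilinearSeries.coeff, mul_comm]

lemma eq_of_forall_hasSum {a b : ℕ → ℂ} {f : ℝ → ℂ}
    (ha : ∀ t : ℝ, HasSum (fun r => a r * (t : ℂ) ^ r) (f t))
    (hb : ∀ t : ℝ, HasSum (fun r => b r * (t : ℂ) ^ r) (f t)) : a = b := by
  have h := (hasPowerSeries_of_forall_hasSum ha).eq_formalMultilinearSeries
    (hasPowerSeries_of_forall_hasSum hb)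
  funext r
  have h' := congrArg (fun p : FormalMultilinearSeries ℝ ℝ ℂ => p.coeff r) h
  simpa [FormalMultilinearSeries.coeff] using h'

section charFun

variable {μ : Measure ℝ}

lemma integrable_exp_abs_mul (h : ∀ t : ℝ, Integrable (fun x => Real.exp (t * x)) μ) (t : ℝ) :
    Integrable (fun x => Real.exp |t * x|) μ := by
  refine ((h t).add (h (-t))).mono' (by fun_prop) (ae_of_all _ fun x => ?_)
  rw [Real.norm_of_nonneg (Real.exp_pos _).le, Pi.add_apply, neg_mul]
  rcases abs_cases (t * x) with ⟨h, -⟩ | ⟨h, -⟩ <;> rw [h]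
  · linarith [Real.exp_pos (-(t * x))]
  · linarith [Real.exp_pos (t * x)]

lemma integrable_pow_of_integrable_exp (h : ∀ t : ℝ, Integrable (fun x => Real.exp (t * x)) μ)
    (r : ℕ) : Integrable (fun x : ℝ => x ^ r) μ := by
  refine ((integrable_exp_abs_mul h 1).const_mul (r.factorial : ℝ)).mono' (by fun_prop)
    (ae_of_all _ fun x => ?_)
  rw [norm_pow, Real.norm_eq_abs, one_mul, ← div_le_iff₀' (by positivity)]
  exact Real.pow_div_factorial_le_exp _ (abs_nonneg x) r

lemma hasSum_charFun (h : ∀ t : ℝ, Integrable (fun x => Real.exp (t * x)) μ) (t : ℝ) :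
    HasSum (fun r : ℕ => ((∫ x, x ^ r ∂μ : ℝ) : ℂ) * Complex.I ^ r / r.factorial * (t : ℂ) ^ r)
      (charFun μ t) := by
  rw [charFun_apply_real]
  have hexp : ∀ x : ℝ, HasSum (fun r : ℕ => |t * x| ^ r / r.factorial) (Real.exp |t * x|) :=
    fun x => by
      rw [Real.exp_eq_exp_ℝ]
      exact NormedSpace.expSeries_div_hasSum_exp _
  have key := hasSum_integral_of_dominated_convergence (μ := μ)
    (F := fun (r : ℕ) (x : ℝ) => ((t * x * Complex.I : ℂ)) ^ r / r.factorial)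
    (f := fun x : ℝ => Complex.exp (t * x * Complex.I))
    (fun r x => |t * x| ^ r / r.factorial) (fun r => by fun_prop)
    (fun r => ae_of_all _ fun x => ?_) (ae_of_all _ fun x => (hexp x).summable) ?_
    (ae_of_all _ fun x => ?_)
  · refine key.congr_fun fun r => ?_
    have : ∀ x : ℝ, ((t * x * Complex.I : ℂ)) ^ r / r.factorial =
        (Complex.I ^ r / r.factorial * (t : ℂ) ^ r) * ((x ^ r : ℝ) : ℂ) := fun x => by
      push_cast; ring
    simp_rw [this]
    rw [integral_const_mul, integral_complex_ofReal]
    ring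
  · rw [norm_div, norm_pow, norm_mul, Complex.norm_I, mul_one, ← Complex.ofReal_mul,
      Complex.norm_real, Real.norm_eq_abs, Complex.norm_natCast]
  · simp_rw [fun x => (hexp x).tsum_eq]
    exact integrable_exp_abs_mul h t
  · rw [Complex.exp_eq_exp_ℂ]
    exact NormedSpace.expSeries_div_hasSum_exp _

/-- The even terms of the exponential series are nonnegative, so monotone convergence applies to
`cosh`, and `exp ≤ 2 cosh`. -/
lemma integrable_exp_of_summable_moments {m : ℕ → ℝ}
    (hi : ∀ r : ℕ, Integrable (fun x : ℝ => x ^ r) μ)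
    (hm : ∀ r : ℕ, ∫ x, x ^ r ∂μ = r.factorial * m r)
    (hs : ∀ t : ℝ, Summable fun r => m r * |t| ^ r) (t : ℝ) :
    Integrable (fun x => Real.exp (t * x)) μ := by
  have hF : ∀ (k : ℕ) (x : ℝ), (t * x) ^ (2 * k) / (2 * k).factorial =
      t ^ (2 * k) / (2 * k).factorial * x ^ (2 * k) := fun k x => by ring
  have h : Integrable (fun x => Real.cosh (t * x)) μ := by
    refine integrable_of_hasSum_of_nonneg
      (F := fun k x => (t * x) ^ (2 * k) / (2 * k).factorial) (fun k => ?_) (fun k x => ?_) ?_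
      (fun x => Real.hasSum_cosh _)
      (Real.continuous_cosh.comp (continuous_const.mul continuous_id)).aestronglyMeasurable
    · simp_rw [hF]
      exact (hi _).const_mul _
    · exact div_nonneg (Even.pow_nonneg (even_two_mul k) _) (by positivity)
    · refine ((hs t).comp_injective (i := fun k => 2 * k) fun a b h => by
        simpa using h).congr fun k => ?_
      simp_rw [hF]
      rw [integral_const_mul, hm, Function.comp_apply, pow_mul, sq_abs, ← pow_mul]
      field_simp
  refine (h.const_mul 2).mono' (by fun_prop) (ae_of_all _ fun x => ?_)
  rw [Real.norm_of_nonneg (Real.exp_pos _).le, Real.cosh_eq]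
  linarith [Real.exp_pos (-(t * x))]

lemma integrable_exp_of_integrable_exp_abs
    (h : ∀ t : ℝ, 0 ≤ t → Integrable (fun x => Real.exp (t * |x|)) μ) (t : ℝ) :
    Integrable (fun x => Real.exp (t * x)) μ := by
  refine (h |t| (abs_nonneg t)).mono' (by fun_prop) (ae_of_all _ fun x => ?_)
  rw [Real.norm_of_nonneg (Real.exp_pos _).le, ← abs_mul]
  exact Real.exp_le_exp.2 (le_abs_self _)

end charFun

/-- A sequence of probability measures on `ℝ` whose characteristic functions converge pointwise to a
function which is continuous at `0` converges weakly to a probability measure. -/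
lemma exists_tendsto_of_tendsto_charFun {μ : ℕ → ProbabilityMeasure ℝ} {φ : ℝ → ℂ}
    (hφ : ContinuousAt φ 0)
    (h : ∀ t, Tendsto (fun n => charFun (μ n : Measure ℝ) t) atTop (𝓝 (φ t))) :
    ∃ ν : ProbabilityMeasure ℝ, Tendsto μ atTop (𝓝 ν) ∧ ∀ t, charFun (ν : Measure ℝ) t = φ t := by
  have htight := isTightMeasureSet_of_tendsto_charFun (μ := fun n => (μ n : Measure ℝ)) hφ h
  have hcomp : IsCompact (closure (Set.range μ)) := by
    refine isCompact_closure_of_isTightMeasureSet ?_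
    convert htight using 1
    ext ξ
    simp
  let g : Ultrafilter ℕ := Ultrafilter.of atTop
  have hg : (g : Filter ℕ) ≤ atTop := Ultrafilter.of_le _
  have hmem : ∀ᶠ n in (g : Filter ℕ), μ n ∈ closure (Set.range μ) :=
    Eventually.of_forall fun n => subset_closure ⟨n, rfl⟩
  -- Compactness only gives a limit along an ultrafilter. Its characteristic function must be `φ`,
  -- and then Lévy's theorem gives convergence of the full sequence.
  obtain ⟨ν, -, hν⟩ := hcomp.ultrafilter_le_nhds (g.map μ) (le_principal_iff.2 hmem)
  have hν' : Tendsto μ g (𝓝 ν) := hν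
  have hc : ∀ t, charFun (ν : Measure ℝ) t = φ t := fun t => by
    rw [ProbabilityMeasure.tendsto_iff_forall_integral_rclike_tendsto ℂ] at hν'
    have h₁ := hν' (BoundedContinuousFunction.innerProbChar t)
    simp_rw [← charFun_eq_integral_innerProbChar] at h₁
    exact tendsto_nhds_unique h₁ ((h t).mono_left hg)
  refine ⟨ν, ProbabilityMeasure.tendsto_of_tendsto_charFun fun t => ?_, hc⟩
  rw [hc]
  exact h t

/-- Fatou's lemma for weak convergence; needed because `f` may be unbounded. -/
lemma integrable_of_tendsto_of_lintegral_le {μ : ℕ → ProbabilityMeasure ℝ}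
    {ν : ProbabilityMeasure ℝ} (h : Tendsto μ atTop (𝓝 ν)) {f : ℝ → ℝ} (hf : Continuous f)
    (hf₀ : 0 ≤ f) {C : ℝ}
    (hC : ∀ᶠ n in atTop, ∫⁻ x, ENNReal.ofReal (f x) ∂(μ n : Measure ℝ) ≤ ENNReal.ofReal C) :
    Integrable f (ν : Measure ℝ) := by
  refine ⟨hf.aestronglyMeasurable, ?_⟩
  rw [hasFiniteIntegral_iff_ofReal (ae_of_all _ hf₀)]
  have h₁ := lintegral_le_liminf_lintegral_of_forall_isOpen_measure_le_liminf_measure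
    (μ := (ν : Measure ℝ)) (μs := fun n => (μ n : Measure ℝ)) hf hf₀
    fun G hG => ProbabilityMeasure.le_liminf_measure_open_of_tendsto h hG
  refine h₁.trans_lt (lt_of_le_of_lt ?_ (ENNReal.ofReal_lt_top (r := C)))
  exact (liminf_le_liminf hC).trans (by simp)

namespace SPNetwork

local notation "ρ" => growthRate

lemma hasSum_limitCharFun (t : ℝ) :
    HasSum (fun r => ((limitMomentDiv r : ℂ) * Complex.I ^ r) * (t : ℂ) ^ r) (limitCharFun t) := by
  have h : Summable fun r => (limitMomentDiv r : ℂ) * (t * Complex.I) ^ r := by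
    refine Summable.of_norm ((summable_limitMomentDiv t).congr fun r => ?_)
    rw [norm_mul, norm_pow, norm_mul, Complex.norm_I, mul_one, Complex.norm_real,
      Complex.norm_real, Real.norm_of_nonneg (limitMomentDiv_nonneg r), Real.norm_eq_abs]
  refine h.hasSum.congr_fun fun r => ?_
  rw [mul_pow]
  ring

lemma continuousAt_limitCharFun : ContinuousAt limitCharFun 0 :=
  (hasPowerSeries_of_forall_hasSum hasSum_limitCharFun).continuousAt

lemma moments_of_charFun_eq {ν : Measure ℝ}
    (h : ∀ t : ℝ, Integrable (fun x => Real.exp (t * x)) ν)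
    (hν : ∀ t, charFun ν t = limitCharFun t) (r : ℕ) :
    ∫ x, x ^ r ∂ν = r.factorial * limitMomentDiv r := by
  have h₁ := congrFun (eq_of_forall_hasSum (fun t => hν t ▸ hasSum_charFun h t)
    hasSum_limitCharFun) r
  have h₂ : (Complex.I : ℂ) ^ r ≠ 0 := pow_ne_zero _ Complex.I_ne_zero
  have h₃ : (r.factorial : ℂ) ≠ 0 := by exact_mod_cast r.factorial_ne_zero
  rw [div_eq_iff h₃, mul_right_comm] at h₁
  have h₄ := mul_right_cancel₀ h₂ h₁
  rw [mul_comm]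
  exact_mod_cast h₄

/-- Determinacy: these moments force exponential integrability, so the characteristic function is
the sum of its moment series. -/
lemma charFun_eq_of_moments {ν : Measure ℝ}
    (hi : ∀ r : ℕ, Integrable (fun x : ℝ => x ^ r) ν)
    (hm : ∀ r : ℕ, ∫ x, x ^ r ∂ν = r.factorial * limitMomentDiv r) (t : ℝ) :
    charFun ν t = limitCharFun t := by
  have h := hasSum_charFun (integrable_exp_of_summable_moments hi hm summable_limitMomentDiv) t
  refine h.unique ((hasSum_limitCharFun t).congr_fun fun r => ?_)
  have h₃ : (r.factorial : ℂ) ≠ 0 := by exact_mod_cast r.factorial_ne_zero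
  rw [hm]
  push_cast
  field_simp

/-! ### The degree of the sink -/

section law

variable {Ω : Type*} [MeasurableSpace Ω] {P : Measure Ω} {n : ℕ}

lemma integrable_comp_sinkDegree {E : Type*} [NormedAddCommGroup E] {G : Ω → SPNetwork n}
    (hG : HasLaw G (binaryModel n).toMeasure P) (f : ℕ → E) :
    Integrable (fun ω => f (G ω).sinkDegree) P := by
  have h := integrable_binaryModel fun H : SPNetwork n => f H.sinkDegree
  rw [← hG.map_eq] at h
  exact h.comp_aemeasurable hG.aemeasurable

lemma integral_comp_sinkDegree {E : Type*} [NormedAddCommGroup E] [NormedSpace ℝ E]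
    {G : Ω → SPNetwork (n + 1)} (hG : HasLaw G (binaryModel (n + 1)).toMeasure P) (f : ℕ → E) :
    ∫ ω, f (G ω).sinkDegree ∂P = mean n fun a b => f (a + b) := by
  rw [mean]
  simp_rw [← sinkDegree_eq]
  exact hG.integral_comp (f := fun H => f H.sinkDegree) AEStronglyMeasurable.of_discrete

end law

lemma tendsto_mean_add_div_scale :
    Tendsto (fun n => mean n (fun a b => ((a + b : ℕ) : ℝ)) / scale n) atTop
      (𝓝 ((1 + √2) / 2 * (1 / Real.Gamma √2))) := by
  have hs := sqrt_two_eq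
  have h₀ : Tendsto (fun n => risingProd (-1 - √2) n / scale n) atTop (𝓝 0) := by
    refine squeeze_zero_norm (fun n => ?_) (tendsto_const_div_scale 3)
    rw [norm_div, Real.norm_eq_abs, Real.norm_of_nonneg (scale_pos n).le]
    have := scale_pos n
    gcongr
    exact abs_risingProd_le_of_nonpos (by linarith [growthRate_pos]) (by linarith [growthRate_lt]) n
  have h := (tendsto_risingProd_div_scale.const_mul ((1 + √2) / 2)).sub
    (h₀.const_mul ((√2 - 1) / 2))
  rw [mul_zero, sub_zero] at h
  refine h.congr fun n => ?_
  rw [mean_add_eq]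
  ring

end SPNetwork

/-! ### Laws of the scaled degree. -/

namespace SPNetwork

local notation "ρ" => growthRate

section sequence

variable {Ω : ℕ → Type*} [∀ n, MeasurableSpace (Ω n)]
  {P : ∀ n, Measure (Ω n)} {G : ∀ n, Ω n → SPNetwork n}

lemma aemeasurable_scaled (hG : ∀ n, HasLaw (G n) (binaryModel n).toMeasure (P n)) (n : ℕ) :
    AEMeasurable (fun ω => ((G n ω).sinkDegree : ℝ) / (n : ℝ) ^ (√2 - 1)) (P n) :=
  (integrable_comp_sinkDegree (hG n) fun d => (d : ℝ) / (n : ℝ) ^ (√2 - 1)).1.aemeasurable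

variable [∀ n, IsProbabilityMeasure (P n)]

/-- The law of the scaled degree of the sink. -/
noncomputable def scaledLaw (hG : ∀ n, HasLaw (G n) (binaryModel n).toMeasure (P n)) (n : ℕ) :
    ProbabilityMeasure ℝ :=
  ⟨(P n).map fun ω => ((G n ω).sinkDegree : ℝ) / (n : ℝ) ^ (√2 - 1),
    Measure.isProbabilityMeasure_map (aemeasurable_scaled hG n)⟩

lemma integral_scaledLaw {E : Type*} [NormedAddCommGroup E] [NormedSpace ℝ E]
    (hG : ∀ n, HasLaw (G n) (binaryModel n).toMeasure (P n)) (n : ℕ) {f : ℝ → E}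
    (hf : Continuous f) :
    ∫ x, f x ∂(scaledLaw hG (n + 1) : Measure ℝ) =
      mean n fun a b => f (((a + b : ℕ) : ℝ) / scale n) := by
  have hs : ((n + 1 : ℕ) : ℝ) ^ (√2 - 1) = scale n := by rw [scale, growthRate]; push_cast; rfl
  rw [← integral_comp_sinkDegree (hG (n + 1)) fun d => f ((d : ℝ) / scale n), scaledLaw]
  simp only [ProbabilityMeasure.coe_mk]
  rw [integral_map (aemeasurable_scaled hG (n + 1)) hf.aestronglyMeasurable, hs]

lemma tendsto_charFun_scaledLaw (hG : ∀ n, HasLaw (G n) (binaryModel n).toMeasure (P n)) (t : ℝ) :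
    Tendsto (fun n => charFun (scaledLaw hG n : Measure ℝ) t) atTop (𝓝 (limitCharFun t)) := by
  rw [← tendsto_add_atTop_iff_nat 1]
  refine (tendsto_mean_exp t).congr fun n => ?_
  rw [charFun_apply_real, integral_scaledLaw hG n (by fun_prop)]
  congr 1 with a b
  congr 1
  push_cast
  ring

lemma lintegral_scaledLaw_le (hG : ∀ n, HasLaw (G n) (binaryModel n).toMeasure (P n)) {τ : ℝ}
    (hτ : 0 ≤ τ) :
    ∃ C : ℝ, ∀ᶠ n in atTop, ∫⁻ x, ENNReal.ofReal (Real.exp (τ * |x|))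
      ∂(scaledLaw hG n : Measure ℝ) ≤ ENNReal.ofReal C := by
  obtain ⟨C, hC⟩ := exists_mean_exp_le hτ
  refine ⟨C, ?_⟩
  rw [eventually_atTop] at hC ⊢
  obtain ⟨N, hN⟩ := hC
  refine ⟨N + 1, fun m hm => ?_⟩
  obtain ⟨n, rfl⟩ := Nat.exists_eq_add_of_le' (Nat.one_le_of_lt hm)
  have hcont : Continuous fun x : ℝ => Real.exp (τ * |x|) := by fun_prop
  have hi : Integrable (fun x : ℝ => Real.exp (τ * |x|)) (scaledLaw hG (n + 1) : Measure ℝ) := by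
    rw [scaledLaw]
    simp only [ProbabilityMeasure.coe_mk]
    rw [integrable_map_measure hcont.aestronglyMeasurable (aemeasurable_scaled hG (n + 1))]
    exact integrable_comp_sinkDegree (hG (n + 1)) fun d =>
      Real.exp (τ * |(d : ℝ) / ((n + 1 : ℕ) : ℝ) ^ (√2 - 1)|)
  rw [← ofReal_integral_eq_lintegral_ofReal hi (ae_of_all _ fun x => (Real.exp_pos _).le),
    integral_scaledLaw hG n hcont]
  refine ENNReal.ofReal_le_ofReal (le_trans (le_of_eq ?_) (hN n (by omega)))
  congr 1 with a b
  rw [abs_of_nonneg (div_nonneg (Nat.cast_nonneg _) (scale_pos n).le)]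

end sequence

end SPNetwork

/-! ### The main theorem. -/

open SPNetwork in
theorem mainTheorem6 {Ω : ℕ → Type*} [∀ n, MeasurableSpace (Ω n)]
    (P : ∀ n, Measure (Ω n)) [∀ n, IsProbabilityMeasure (P n)]
    (G : ∀ n, Ω n → SPNetwork n)
    (hG : ∀ n, HasLaw (G n) (SPNetwork.binaryModel n).toMeasure (P n)) :
    (∀ n : ℕ, 1 ≤ n →
      Integrable (fun ω => ((G n ω).sinkDegree : ℝ)) (P n) ∧
      ∫ ω, ((G n ω).sinkDegree : ℝ) ∂(P n) =
        (1 + √2) / 2 * Ring.choose ((n : ℝ) + √2 - 2) (n - 1)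
          - (√2 - 1) / 2 * Ring.choose ((n : ℝ) - √2 - 2) (n - 1)) ∧
    (fun n : ℕ => ∫ ω, ((G n ω).sinkDegree : ℝ) ∂(P n)) ~[atTop]
      (fun n : ℕ => (1 + √2) / 2 * ((n : ℝ) ^ (√2 - 1) / Real.Gamma √2)) ∧
    ∃ c : ℕ → ℝ,
      c 0 = 1 ∧
      c 1 = (1 + √2) / (2 * √2) ∧
      (∀ r : ℕ, 2 ≤ r →
        c r = 1 / (((r : ℝ) * (√2 - 1) + 1) ^ 2 - 2) *
          ∑ k ∈ Finset.Icc 1 (r - 1), c k * c (r - k)) ∧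
      ∃ ν : ProbabilityMeasure ℝ,
        TendstoInDistribution
          (fun (n : ℕ) (ω : Ω n) => ((G n ω).sinkDegree : ℝ) / (n : ℝ) ^ (√2 - 1))
          atTop (id : ℝ → ℝ) P (ν : Measure ℝ) ∧
        (∀ r : ℕ, Integrable (fun x : ℝ => x ^ r) (ν : Measure ℝ) ∧
          ∫ x, x ^ r ∂(ν : Measure ℝ) =
            (r.factorial : ℝ) * ((r : ℝ) * (√2 - 1) + 1) * c r /
              Real.Gamma ((r : ℝ) * (√2 - 1) + 1)) ∧
        (∀ ν' : ProbabilityMeasure ℝ,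
          (∀ r : ℕ, Integrable (fun x : ℝ => x ^ r) (ν' : Measure ℝ) ∧
            ∫ x, x ^ r ∂(ν' : Measure ℝ) = ∫ x, x ^ r ∂(ν : Measure ℝ)) → ν' = ν) := by
  have hmean : ∀ n, ∫ ω, ((G (n + 1) ω).sinkDegree : ℝ) ∂(P (n + 1)) =
      mean n fun a b => ((a + b : ℕ) : ℝ) := fun n =>
    integral_comp_sinkDegree (hG (n + 1)) fun d => (d : ℝ)
  refine ⟨fun n hn => ⟨integrable_comp_sinkDegree (hG n) fun d => (d : ℝ), ?_⟩, ?_, limitCoeff,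
    limitCoeff.eq_1, limitCoeff.eq_2, fun r hr => limitCoeff_eq hr, ?_⟩
  · obtain ⟨n, rfl⟩ := Nat.exists_eq_add_of_le' hn
    rw [hmean, mean_add_eq, Nat.add_sub_cancel, ← choose_eq_risingProd, ← choose_eq_risingProd,
      growthRate]
    push_cast
    congr 3 <;> ring
  · refine isEquivalent_of_tendsto_one ?_
    rw [← tendsto_add_atTop_iff_nat 1]
    have hL : (1 + √2) / 2 * (1 / Real.Gamma √2) ≠ 0 := by positivity
    have h := tendsto_mean_add_div_scale.div_const ((1 + √2) / 2 * (1 / Real.Gamma √2))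
    rw [div_self hL] at h
    refine h.congr fun n => ?_
    have hs : ((n + 1 : ℕ) : ℝ) ^ (√2 - 1) = scale n := by rw [scale, growthRate]; push_cast; rfl
    rw [Pi.div_apply, hmean, hs, div_div]
    congr 1
    ring
  · obtain ⟨ν, hν, hc⟩ := exists_tendsto_of_tendsto_charFun continuousAt_limitCharFun
      (tendsto_charFun_scaledLaw hG)
    -- Weak convergence does not carry moments along; uniform exponential bounds pass to `ν`, and
    -- its moments are then read off from its characteristic function.
    have hexp := integrable_exp_of_integrable_exp_abs (μ := (ν : Measure ℝ)) fun t ht => by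
      obtain ⟨C, hC⟩ := lintegral_scaledLaw_le hG ht
      exact integrable_of_tendsto_of_lintegral_le hν (by fun_prop)
        (fun x => (Real.exp_pos _).le) hC
    have hm := moments_of_charFun_eq hexp hc
    refine ⟨ν, ⟨aemeasurable_scaled hG, aemeasurable_id, ?_⟩,
      fun r => ⟨integrable_pow_of_integrable_exp hexp r, ?_⟩, fun ν' hν' => ?_⟩
    · have h : (⟨(ν : Measure ℝ).map id, Measure.isProbabilityMeasure_map aemeasurable_id⟩ :
          ProbabilityMeasure ℝ) = ν := Subtype.ext Measure.map_id
      rw [h]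
      exact hν
    · rw [hm, limitMomentDiv, growthRate]
      ring
    · refine Subtype.ext (Measure.ext_of_charFun (μ := (ν' : Measure ℝ)) (ν := (ν : Measure ℝ))
        (funext fun t => ?_))
      rw [charFun_eq_of_moments (fun r => (hν' r).1) (fun r => (hν' r).2.trans (hm r)) t]
      exact (hc t).symm
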